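/- Let $\Lambda$ be a finite set of sites and let $\Phi$ be a compact subgroup of $\mathbb{R}/2\pi\mathbb{Z}$, equipped with a Haar measure $\mu$ (a nonzero finite translation-invariant measure, with any normalization). Let $I$ be a finite set of triples $(ij,m)$, where $ij=(i,j)\in\Lambda\times\Lambda$ is a bond with a chosen orientation and $m\in\mathbb{Z}$. For each $(ij,m)\in I$ let $\beta_{ij,m}>0$, $\sigma_{ij,m}>0$, $D_{ij,m}\ge 0$, and let $J_{ij,m}\sim N(D_{ij,m},\sigma_{ij,m}^2)$ and $K_{ij,m}\sim N(0,\sigma_{ij,m}^2)$ be independent Gaussian random variables, all independent of each other. For $\phi\in\Phi^\Lambda$ put $$U(\phi)=-\sum_{(ij,m)\in I}\beta_{ij,m}\bigl(J_{ij,m}\cos m(\phi_i-\phi_j)+K_{ij,m}\sin m(\phi_i-\phi_j)\bigr),$$ $$Z=\int e^{-U(\phi)}\prod_{i\in\Lambda}d\mu(\phi_i),\qquad \langle f\rangle=\frac1Z\int f(\phi)\,e^{-U(\phi)}\prod_{i\in\Lambda}d\mu(\phi_i),$$ write $\langle f;g\rangle=\langle fg\rangle-\langle f\rangle\langle g\rangle$,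 and let $\mathbb{E}$ be the expectation over the $J$'s and $K$'s. Impose the Nishimori-line condition $D_{ij,m}/\sigma_{ij,m}^2=\beta_{ij,m}$ for all $(ij,m)\in I$, and parametrize the Nishimori line by $x_{ij,m}=\beta_{ij,m}D_{ij,m}=\sigma_{ij,m}^2\beta_{ij,m}^2>0$ (for each $x$ any choice of $\beta$, $D$, $\sigma$ with these relations is allowed). Then, for any two $(ij,m),(kl,n)\in I$ (possibly equal) and every $x\in(0,\infty)^I$, the expectations and partial derivatives below exist, and $$\begin{aligned} 2\,\frac{\partial^2}{\partial x_{ij,m}\,\partial x_{kl,n}}\mathbb{E}[\log Z] &=\frac{\partial}{\partial x_{kl,n}}\mathbb{E}\bigl[\langle\cos m(\phi_i-\phi_j)\rangle\bigr]\\ &=\mathbb{E}\bigl[\langle\cos m(\phi_i-\phi_j);\cos n(\phi_k-\phi_l)\rangle^2\bigr] +\mathbb{E}\bigl[\langle\cos m(\phi_i-\phi_j);\sin n(\phi_k-\phi_l)\rangle^2\bigr]\\ &\quad+\mathbb{E}\bigl[\langle\sin m(\phi_i-\phi_j);\cos n(\phi_k-\phi_l)\rangle^2\bigr] +\mathbb{E}\bigl[\langle\sin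 m(\phi_i-\phi_j);\sin n(\phi_k-\phi_l)\rangle^2\bigr]\ \ge 0 . \end{aligned}$$ Consequently $x\mapsto\mathbb{E}[\langle\cos m(\phi_i-\phi_j)\rangle]$ is nondecreasing on $(0,\infty)^I$ with respect to the coordinatewise order. -/

import Mathlib

open MeasureTheory ProbabilityTheory
open scoped NNReal

noncomputable section

namespace GaugeGlass

/-- The parameters of the Gaussian disorder: for every interaction `b`, the local inverse
temperature `β b > 0`, the mean `D b ≥ 0` and the standard deviation `σ b > 0`. -/
structure Couplings (ι : Type*) where
  β : ι → ℝ
  D : ι → ℝ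
  σ : ι → ℝ≥0
  β_pos : ∀ b, 0 < β b
  D_nonneg : ∀ b, 0 ≤ D b
  σ_pos : ∀ b, 0 < σ b

/-- The Nishimori-line condition `D / σ² = β`. -/
def Couplings.OnNishimoriLine {ι : Type*} (c : Couplings ι) : Prop :=
  ∀ b, c.D b / (c.σ b : ℝ) ^ 2 = c.β b

/-- The parameter `x = β D` of a point of the Nishimori line. -/
def Couplings.x {ι : Type*} (c : Couplings ι) (b : ι) : ℝ := c.β b * c.D b

/-- The law of the disorder: independent complex Gaussians `ω b = J b - i K b`, recorded as
the pairs `(J b, K b)`, with `J b ∼ N(D b, σ b ^ 2)` and `K b ∼ N(0, σ b ^ 2)` independent. -/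
def disorder {ι : Type*} [Fintype ι] (c : Couplings ι) : Measure (ι → ℝ × ℝ) :=
  Measure.pi fun b => (gaussianReal (c.D b) (c.σ b ^ 2)).prod (gaussianReal 0 (c.σ b ^ 2))

/-- The partial derivative of `f` in the coordinate `b` at the point `x`. -/
def partialDeriv {ι : Type*} [DecidableEq ι] (b : ι) (f : (ι → ℝ) → ℝ) (x : ι → ℝ) : ℝ :=
  deriv (fun t => f (Function.update x b t)) (x b)

/-- Existence of the partial derivative of `f` in the coordinate `b` at the point `x`. -/
def HasPartial {ι : Type*} [DecidableEq ι] (b : ι) (f : (ι → ℝ) → ℝ) (x : ι → ℝ) : Prop :=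
  DifferentiableAt ℝ (fun t => f (Function.update x b t)) (x b)

section Model

variable {Λ : Type*} {Φ : AddSubgroup Real.Angle}

/-- The interaction `(i, j, m)` enters through the angle `m (φ_i - φ_j)`. -/
def angle (a : Λ × Λ × ℤ) (φ : Λ → Φ) : Real.Angle :=
  a.2.2 • ((φ a.1 : Real.Angle) - (φ a.2.1 : Real.Angle))

/-- `cos m(φ_i - φ_j)`. -/
def cosMode (a : Λ × Λ × ℤ) (φ : Λ → Φ) : ℝ := (angle a φ).cos

/-- `sin m(φ_i - φ_j)`. -/
def sinMode (a : Λ × Λ × ℤ) (φ : Λ → Φ) : ℝ := (angle a φ).sin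

variable {I : Finset (Λ × Λ × ℤ)}

/-- The random potential; `I` is the finite set of the triples `(i, j, m)` such that `(i, j)` is a
bond, each with a chosen orientation, and `m` is one of the integers that occur on that bond.
Each summand is `β Re (ω exp (i m (φ_i - φ_j)))` with `ω = J - i K`. -/
def potential (c : Couplings I) (ω : I → ℝ × ℝ) (φ : Λ → Φ) : ℝ :=
  -∑ b : I, c.β b * ((ω b).1 * cosMode b.1 φ + (ω b).2 * sinMode b.1 φ)

variable [Fintype Λ] [MeasurableSpace Φ]

/-- The partition function. -/
def partitionFunction (μ : Measure Φ) (c : Couplings I) (ω : I → ℝ × ℝ) : ℝ :=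
  ∫ φ : Λ → Φ, Real.exp (-potential c ω φ) ∂(Measure.pi fun _ => μ)

/-- The thermal average `⟨f⟩`. -/
def thermal (μ : Measure Φ) (c : Couplings I) (ω : I → ℝ × ℝ) (f : (Λ → Φ) → ℝ) : ℝ :=
  (∫ φ : Λ → Φ, f φ * Real.exp (-potential c ω φ) ∂(Measure.pi fun _ => μ)) /
    partitionFunction μ c ω

/-- The truncated correlation `⟨f g⟩ - ⟨f⟩⟨g⟩`. -/
def truncated (μ : Measure Φ) (c : Couplings I) (ω : I → ℝ × ℝ) (f g : (Λ → Φ) → ℝ) : ℝ :=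
  thermal μ c ω (fun φ => f φ * g φ) - thermal μ c ω f * thermal μ c ω g

/-- The quenched pressure `𝔼[log Z]`. -/
def pressure (μ : Measure Φ) (c : Couplings I) : ℝ :=
  ∫ ω, Real.log (partitionFunction μ c ω) ∂(disorder c)

/-- The quenched correlation `𝔼⟨cos m(φ_i - φ_j)⟩`. -/
def correlation (μ : Measure Φ) (c : Couplings I) (a : Λ × Λ × ℤ) : ℝ :=
  ∫ ω, thermal μ c ω (cosMode a) ∂(disorder c)

end Model

end GaugeGlass

end

/-!
After rescaling, the Gibbs measure depends on the couplings only through `h b = β b * J b` and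
`k b = β b * K b`. On the Nishimori line the pair `(h b, k b)` has law `N(x b, x b) ⊗ N(0, x b)`,
so all disorder expectations are functions of `x` alone
(`Couplings.measurePreserving_rescale`). Two facts about this law carry the proof.

*Heat equation.* The law `N(t, t) ⊗ N(0, t)` is that at time `t` of the diffusion with generator
`∂₁ + (∂₁₁ + ∂₂₂) / 2` (`PlanarJet.hasDerivAt_integral`, by Gaussian integration by parts), hence
the derivative in `x b` of the expectation of `F` is the expectation of the generator applied to `F`
in the coupling at `b` (`hasDerivAt_integral_nishimoriLaw`). Because `cos ^ 2 + sin ^ 2 = 1`, the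
Laplacians of `log Z` and of `⟨f⟩` involve only `⟨c⟩ ^ 2 + ⟨s⟩ ^ 2`, respectively
`⟨f; c⟩⟨c⟩ + ⟨f; s⟩⟨s⟩`, where `c` and `s` are the cosine and the sine of the mode `b`.

*Nishimori identity.* The law is the tilt by `exp (h b - x b / 2)` of a rotation invariant law.
Rotating every coupling by the angle `-m (ψ_i - ψ_j)` turns `∑ b, h b` into the Gibbs exponent of
the configuration `ψ` and translates the Gibbs measure by `-ψ`. Averaging over `ψ` against the Haar
measure shows that the disorder expectation of `G` equals that of the thermal average over `ψ` of
the gauge transforms of `G` (`integral_nishimoriLaw_eq_zero`). For `G = ⟨c⟩` this average is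
`⟨c⟩ ^ 2 + ⟨s⟩ ^ 2`, which gives `∂ E[log Z] / ∂ x b = (1 + E⟨c⟩) / 2`
(`hasDerivAt_integral_log_partition_cosModes`). For the generator applied to `⟨cos⟩` in the mode `a`
it is the sum of the squares of the four truncated correlations
(`integral_generator_average_cosModes`), which gives the second identity and the sign. Monotonicity
follows by raising one coordinate at a time.
-/

namespace GaugeGlass

/-! ### Gaussian laws of the plane and the heat equation -/

section Gaussian

/-- The standard Gaussian measure of the plane. -/
noncomputable def planarGaussian : Measure (ℝ × ℝ) := (gaussianReal 0 1).prod (gaussianReal 0 1)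

/-- The law `N(t, t) ⊗ N(0, t)` of a pair of rescaled couplings `(β J, β K)` at the point `t` of
the Nishimori line. -/
noncomputable def planarLaw (t : ℝ) : Measure (ℝ × ℝ) :=
  (gaussianReal t t.toNNReal).prod (gaussianReal 0 t.toNNReal)

instance : IsProbabilityMeasure planarGaussian := by unfold planarGaussian; infer_instance

instance (t : ℝ) : IsProbabilityMeasure (planarLaw t) := by unfold planarLaw; infer_instance

theorem measurePreserving_planarLaw {t : ℝ} (ht : 0 ≤ t) :
    MeasurePreserving (fun z : ℝ × ℝ => (t + √t * z.1, √t * z.2)) planarGaussian (planarLaw t) := by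
  have key : ∀ m : ℝ, MeasurePreserving (fun g : ℝ => m + √t * g) (gaussianReal 0 1)
      (gaussianReal m t.toNNReal) := by
    intro m
    refine ⟨by fun_prop, ?_⟩
    have h : (fun g : ℝ => m + √t * g) = (fun y => m + y) ∘ fun g => √t * g := rfl
    rw [h, ← Measure.map_map (by fun_prop) (by fun_prop), gaussianReal_map_const_mul,
      gaussianReal_map_const_add]
    congr 1
    · simp
    · ext
      simp [Real.sq_sqrt ht, Real.coe_toNNReal t ht]
  have h2 := key 0
  simp only [zero_add] at h2
  exact (key t).prod h2

/-- Gaussian integration by parts. -/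
theorem integral_mul_gaussianReal {f f' : ℝ → ℝ} {M : ℝ} (hf : ∀ s, HasDerivAt f (f' s) s)
    (hf' : Measurable f') (hM : ∀ s, |f s| ≤ M) (hM' : ∀ s, |f' s| ≤ M) :
    ∫ s, s * f s ∂(gaussianReal 0 1) = ∫ s, f' s ∂(gaussianReal 0 1) := by
  have hfc : Continuous f := continuous_iff_continuousAt.2 fun s => (hf s).continuousAt
  set p := gaussianPDFReal 0 1 with hp
  have hpint : Integrable p := integrable_gaussianPDFReal 0 1
  have hpd : ∀ s, HasDerivAt p (-s * p s) s := by
    intro s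
    have h1 : HasDerivAt (fun s : ℝ => -(s - 0) ^ 2 / (2 * ((1 : ℝ≥0) : ℝ))) (-s) s := by
      have := (((hasDerivAt_id s).sub_const 0).pow 2).neg.div_const (2 * ((1 : ℝ≥0) : ℝ))
      refine this.congr_deriv ?_
      simp only [id, NNReal.coe_one]
      ring
    have h2 := h1.exp.const_mul (√(2 * Real.pi * ((1 : ℝ≥0) : ℝ)))⁻¹
    refine h2.congr_deriv ?_
    simp only [hp, gaussianPDFReal]
    ring
  have hsp : Integrable (fun s => s * p s) := by
    have := (memLp_id_gaussianReal (μ := 0) (v := 1) 1).integrable (le_refl _)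
    rw [gaussianReal_of_var_ne_zero 0 one_ne_zero,
      integrable_withDensity_iff (measurable_gaussianPDF 0 1)
        (Filter.Eventually.of_forall fun _ => gaussianPDF_lt_top)] at this
    simpa [toReal_gaussianPDF] using this
  rw [integral_gaussianReal_eq_integral_smul one_ne_zero,
    integral_gaussianReal_eq_integral_smul one_ne_zero]
  have hI1 : Integrable (f * fun s => -s * p s) := by
    have := hsp.neg.bdd_mul (c := M) hfc.aestronglyMeasurable
      (Filter.Eventually.of_forall fun s => by simpa using hM s)
    refine this.congr (Filter.Eventually.of_forall fun s => ?_)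
    simp
  have hI2 : Integrable (f' * p) :=
    hpint.bdd_mul (c := M) hf'.aestronglyMeasurable
      (Filter.Eventually.of_forall fun s => by simpa using hM' s)
  have hI3 : Integrable (f * p) :=
    hpint.bdd_mul (c := M) hfc.aestronglyMeasurable
      (Filter.Eventually.of_forall fun s => by simpa using hM s)
  have := integral_mul_deriv_eq_deriv_mul_of_integrable (u := f) (v := p) (u' := f')
    (v' := fun s => -s * p s) (fun s _ => hf s) (fun s _ => hpd s) hI1 hI2 hI3
  simp only [smul_eq_mul]
  rw [← neg_inj, ← integral_neg]
  calc ∫ s, -(p s * (s * f s)) = ∫ s, f s * (-s * p s) := by congr 1; ext s; ring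
    _ = -∫ s, f' s * p s := this
    _ = _ := by congr 2; ext s; ring

theorem integrable_planarGaussian_abs_fst : Integrable (fun z : ℝ × ℝ => |z.1|) planarGaussian :=
  (((memLp_id_gaussianReal (μ := 0) (v := 1) 1).integrable (le_refl _)).comp_fst _).abs

theorem integrable_planarGaussian_abs_snd : Integrable (fun z : ℝ × ℝ => |z.2|) planarGaussian :=
  (((memLp_id_gaussianReal (μ := 0) (v := 1) 1).integrable (le_refl _)).comp_snd _).abs

/-- Gaussian integration by parts in the first coordinate of the plane. -/
theorem integral_fst_mul_planarGaussian {F F' : ℝ × ℝ → ℝ} {M : ℝ} (hF : Measurable F)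
    (hF' : Measurable F') (hd : ∀ z, HasDerivAt (fun s => F (s, z.2)) (F' z) z.1)
    (hM : ∀ z, |F z| ≤ M) (hM' : ∀ z, |F' z| ≤ M) :
    ∫ z, z.1 * F z ∂planarGaussian = ∫ z, F' z ∂planarGaussian := by
  have h1 : Integrable (fun z : ℝ × ℝ => z.1 * F z) planarGaussian := by
    refine (integrable_planarGaussian_abs_fst.mul_const M).mono' (by fun_prop) ?_
    refine Filter.Eventually.of_forall fun z => ?_
    rw [Real.norm_eq_abs, abs_mul]
    exact mul_le_mul_of_nonneg_left (hM z) (abs_nonneg _)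
  have h2 : Integrable F' planarGaussian :=
    (integrable_const M).mono' hF'.aestronglyMeasurable (Filter.Eventually.of_forall hM')
  unfold planarGaussian at h1 h2 ⊢
  rw [integral_prod_symm _ h1, integral_prod_symm _ h2]
  congr 1
  ext k
  exact integral_mul_gaussianReal (fun s => hd (s, k)) (by fun_prop) (fun s => hM (s, k))
    (fun s => hM' (s, k))

/-- Gaussian integration by parts in the second coordinate of the plane. -/
theorem integral_snd_mul_planarGaussian {F F' : ℝ × ℝ → ℝ} {M : ℝ} (hF : Measurable F)
    (hF' : Measurable F') (hd : ∀ z, HasDerivAt (fun s => F (z.1, s)) (F' z) z.2)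
    (hM : ∀ z, |F z| ≤ M) (hM' : ∀ z, |F' z| ≤ M) :
    ∫ z, z.2 * F z ∂planarGaussian = ∫ z, F' z ∂planarGaussian := by
  have h1 : Integrable (fun z : ℝ × ℝ => z.2 * F z) planarGaussian := by
    refine (integrable_planarGaussian_abs_snd.mul_const M).mono' (by fun_prop) ?_
    refine Filter.Eventually.of_forall fun z => ?_
    rw [Real.norm_eq_abs, abs_mul]
    exact mul_le_mul_of_nonneg_left (hM z) (abs_nonneg _)
  have h2 : Integrable F' planarGaussian :=
    (integrable_const M).mono' hF'.aestronglyMeasurable (Filter.Eventually.of_forall hM')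
  unfold planarGaussian at h1 h2 ⊢
  rw [integral_prod _ h1, integral_prod _ h2]
  congr 1
  ext k
  exact integral_mul_gaussianReal (fun s => hd (k, s)) (by fun_prop) (fun s => hM (k, s))
    (fun s => hM' (k, s))

/-- A function of the plane with its first partial derivatives `∂₁`, `∂₂` and its pure second
partial derivatives `∂₁₁`, `∂₂₂`, all of them bounded by `M`. -/
structure PlanarJet (M : ℝ) (F F₁ F₂ F₁₁ F₂₂ : ℝ × ℝ → ℝ) : Prop where
  hasFDerivAt : ∀ z, HasFDerivAt F
    (F₁ z • ContinuousLinearMap.fst ℝ ℝ ℝ + F₂ z • ContinuousLinearMap.snd ℝ ℝ ℝ) z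
  hasDerivAt_fst : ∀ z, HasDerivAt (fun s => F₁ (s, z.2)) (F₁₁ z) z.1
  hasDerivAt_snd : ∀ z, HasDerivAt (fun s => F₂ (z.1, s)) (F₂₂ z) z.2
  measurable₁ : Measurable F₁
  measurable₂ : Measurable F₂
  measurable₁₁ : Measurable F₁₁
  measurable₂₂ : Measurable F₂₂
  bound₁ : ∀ z, |F₁ z| ≤ M
  bound₂ : ∀ z, |F₂ z| ≤ M
  bound₁₁ : ∀ z, |F₁₁ z| ≤ M
  bound₂₂ : ∀ z, |F₂₂ z| ≤ M

variable {M : ℝ} {F F₁ F₂ F₁₁ F₂₂ : ℝ × ℝ → ℝ}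

theorem PlanarJet.abs_generator_le (h : PlanarJet M F F₁ F₂ F₁₁ F₂₂) (z : ℝ × ℝ) :
    |F₁ z + (F₁₁ z + F₂₂ z) / 2| ≤ 2 * M := by
  have a := abs_le.1 (h.bound₁ z)
  have b := abs_le.1 (h.bound₁₁ z)
  have c := abs_le.1 (h.bound₂₂ z)
  exact abs_le.2 ⟨by linarith, by linarith⟩

theorem PlanarJet.abs_le (h : PlanarJet M F F₁ F₂ F₁₁ F₂₂) (z : ℝ × ℝ) :
    |F z| ≤ |F 0| + M * (|z.1| + |z.2|) := by
  have hd : ∀ s : ℝ,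
      HasDerivAt (fun s : ℝ => F (s • z)) (F₁ (s • z) * z.1 + F₂ (s • z) * z.2) s := by
    intro s
    have h1 : HasDerivAt (fun s : ℝ => s • z) z s := by
      simpa using (hasDerivAt_id s).smul_const z
    refine ((h.hasFDerivAt (s • z)).comp_hasDerivAt s h1).congr_deriv ?_
    simp
  have hb := Convex.norm_image_sub_le_of_norm_hasDerivWithin_le (s := Set.univ)
    (C := M * (|z.1| + |z.2|)) (x := 0) (y := 1)
    (fun s _ => (hd s).hasDerivWithinAt) (fun s _ => ?_) convex_univ (Set.mem_univ _)
    (Set.mem_univ _)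
  · simp only [one_smul, zero_smul, Real.norm_eq_abs, sub_zero, abs_one, mul_one] at hb
    calc |F z| = |F 0 + (F z - F 0)| := by ring_nf
      _ ≤ _ := (abs_add_le _ _).trans (by linarith)
  · rw [Real.norm_eq_abs, mul_add]
    refine (abs_add_le _ _).trans (add_le_add ?_ ?_) <;> rw [abs_mul]
    · exact mul_le_mul_of_nonneg_right (h.bound₁ _) (abs_nonneg _)
    · exact mul_le_mul_of_nonneg_right (h.bound₂ _) (abs_nonneg _)

/-- The heat equation with drift: the law `N(t, t) ⊗ N(0, t)` is that at time `t` of the planar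
diffusion with generator `∂₁ + (∂₁₁ + ∂₂₂) / 2`. -/
theorem PlanarJet.hasDerivAt_integral (h : PlanarJet M F F₁ F₂ F₁₁ F₂₂) {t₀ : ℝ} (ht₀ : 0 < t₀) :
    HasDerivAt (fun t => ∫ z, F z ∂(planarLaw t))
      (∫ z, F₁ z + (F₁₁ z + F₂₂ z) / 2 ∂(planarLaw t₀)) t₀ := by
  have hFc : Continuous F := continuous_iff_continuousAt.2 fun z => (h.hasFDerivAt z).continuousAt
  have m1 := h.measurable₁
  have m2 := h.measurable₂
  have m11 := h.measurable₁₁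
  have m22 := h.measurable₂₂
  have hM0 : 0 ≤ M := (abs_nonneg _).trans (h.bound₁ 0)
  set P : ℝ → ℝ × ℝ → ℝ × ℝ := fun t z => (t + √t * z.1, √t * z.2) with hP
  have hPc : ∀ t, Continuous (P t) := fun t => by rw [hP]; fun_prop
  have hmap : ∀ (G : ℝ × ℝ → ℝ) (t : ℝ), 0 < t → Measurable G →
      ∫ z, G z ∂(planarLaw t) = ∫ z, G (P t z) ∂planarGaussian := by
    intro G t ht hG
    rw [← (measurePreserving_planarLaw ht.le).map_eq, integral_map (hPc t).aemeasurable
      hG.aestronglyMeasurable]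
  have i1 := integrable_planarGaussian_abs_fst
  have i2 := integrable_planarGaussian_abs_snd
  -- Near `t₀` the derivative `1 / (2 * √t)` of the square root is at most its value at `t₀ / 2`.
  have hs : Set.Ioi (t₀ / 2) ∈ nhds t₀ := Ioi_mem_nhds (by linarith)
  set c := 1 / (2 * √(t₀ / 2)) with hc
  have hmain := hasDerivAt_integral_of_dominated_loc_of_deriv_le (μ := planarGaussian) hs
    (F := fun t z => F (P t z))
    (F' := fun t z => F₁ (P t z) * (1 + 1 / (2 * √t) * z.1) + F₂ (P t z) * (1 / (2 * √t) * z.2))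
    (bound := fun z => M * (1 + c * |z.1|) + M * (c * |z.2|)) (x₀ := t₀)
    (Filter.Eventually.of_forall fun t => (hFc.comp (hPc t)).aestronglyMeasurable) ?_ ?_ ?_ ?_ ?_
  · have hev : (fun t => ∫ z, F z ∂(planarLaw t)) =ᶠ[nhds t₀]
        fun t => ∫ z, F (P t z) ∂planarGaussian := by
      filter_upwards [Ioi_mem_nhds ht₀] with t ht
      exact hmap F t ht hFc.measurable
    refine (hmain.2.congr_of_eventuallyEq hev).congr_deriv ?_
    rw [hmap _ t₀ ht₀ (by fun_prop)]
    have hr : 0 < √t₀ := Real.sqrt_pos.2 ht₀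
    have mP := (hPc t₀).measurable
    have s1 := integral_fst_mul_planarGaussian (F := fun z => F₁ (P t₀ z))
      (F' := fun z => √t₀ * F₁₁ (P t₀ z)) (M := max M (√t₀ * M)) (by fun_prop) (by fun_prop)
      (fun z => by
        have hi : HasDerivAt (fun s => t₀ + √t₀ * s) (√t₀) z.1 := by
          simpa using ((hasDerivAt_id z.1).const_mul (√t₀)).const_add t₀
        refine ((h.hasDerivAt_fst (P t₀ z)).comp z.1 hi).congr_deriv (mul_comm _ _))
      (fun z => (h.bound₁ _).trans (le_max_left _ _))
      (fun z => by
        rw [abs_mul, abs_of_pos hr]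
        exact (mul_le_mul_of_nonneg_left (h.bound₁₁ _) hr.le).trans (le_max_right _ _))
    have s2 := integral_snd_mul_planarGaussian (F := fun z => F₂ (P t₀ z))
      (F' := fun z => √t₀ * F₂₂ (P t₀ z)) (M := max M (√t₀ * M)) (by fun_prop) (by fun_prop)
      (fun z => by
        have hi : HasDerivAt (fun s => √t₀ * s) (√t₀) z.2 := by
          simpa using (hasDerivAt_id z.2).const_mul (√t₀)
        refine ((h.hasDerivAt_snd (P t₀ z)).comp z.2 hi).congr_deriv (mul_comm _ _))
      (fun z => (h.bound₂ _).trans (le_max_left _ _))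
      (fun z => by
        rw [abs_mul, abs_of_pos hr]
        exact (mul_le_mul_of_nonneg_left (h.bound₂₂ _) hr.le).trans (le_max_right _ _))
    have hbd : ∀ G : ℝ × ℝ → ℝ, Measurable G → (∀ z, |G z| ≤ M) →
        Integrable (fun z => G (P t₀ z)) planarGaussian := fun G hG hGM =>
      (integrable_const M).mono' (hG.comp mP).aestronglyMeasurable
        (Filter.Eventually.of_forall fun z => hGM _)
    have j1 : Integrable (fun z : ℝ × ℝ => z.1 * F₁ (P t₀ z)) planarGaussian := by
      refine (i1.mul_const M).mono' (by fun_prop) (Filter.Eventually.of_forall fun z => ?_)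
      rw [Real.norm_eq_abs, abs_mul]
      exact mul_le_mul_of_nonneg_left (h.bound₁ _) (abs_nonneg _)
    have j2 : Integrable (fun z : ℝ × ℝ => z.2 * F₂ (P t₀ z)) planarGaussian := by
      refine (i2.mul_const M).mono' (by fun_prop) (Filter.Eventually.of_forall fun z => ?_)
      rw [Real.norm_eq_abs, abs_mul]
      exact mul_le_mul_of_nonneg_left (h.bound₂ _) (abs_nonneg _)
    have k1 := hbd F₁ m1 h.bound₁
    have k11 := hbd F₁₁ m11 h.bound₁₁
    have k22 := hbd F₂₂ m22 h.bound₂₂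
    have j12 : Integrable (fun z : ℝ × ℝ => z.1 * F₁ (P t₀ z) + z.2 * F₂ (P t₀ z))
        planarGaussian := j1.add j2
    have k12 : Integrable (fun z => F₁₁ (P t₀ z) + F₂₂ (P t₀ z)) planarGaussian := k11.add k22
    rw [integral_const_mul] at s1 s2
    calc _ = ∫ z, (F₁ (P t₀ z) + 1 / (2 * √t₀) * (z.1 * F₁ (P t₀ z)
              + z.2 * F₂ (P t₀ z))) ∂planarGaussian := by
            congr 1; ext z; ring
      _ = (∫ z, F₁ (P t₀ z) ∂planarGaussian) + 1 / (2 * √t₀) *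
            ((∫ z, z.1 * F₁ (P t₀ z) ∂planarGaussian)
              + ∫ z, z.2 * F₂ (P t₀ z) ∂planarGaussian) := by
            rw [integral_add k1 (j12.const_mul _), integral_const_mul, integral_add j1 j2]
      _ = (∫ z, F₁ (P t₀ z) ∂planarGaussian) + ((∫ z, F₁₁ (P t₀ z) ∂planarGaussian)
            + ∫ z, F₂₂ (P t₀ z) ∂planarGaussian) / 2 := by
            rw [s1, s2]; field_simp
      _ = _ := by
            rw [integral_add k1 (k12.div_const 2), integral_div, integral_add k11 k22]
  · have hb : Integrable (fun z : ℝ × ℝ => |F 0| + M * ((t₀ + √t₀ * |z.1|) + √t₀ * |z.2|))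
        planarGaussian :=
      (integrable_const _).add ((((integrable_const _).add (i1.const_mul _)).add
        (i2.const_mul _)).const_mul _)
    refine hb.mono' (hFc.comp (hPc t₀)).aestronglyMeasurable
      (Filter.Eventually.of_forall fun z => ?_)
    refine (h.abs_le _).trans ?_
    gcongr
    · refine (abs_add_le _ _).trans (le_of_eq ?_)
      rw [abs_mul, abs_of_pos ht₀, abs_of_nonneg (Real.sqrt_nonneg _)]
    · rw [abs_mul, abs_of_nonneg (Real.sqrt_nonneg _)]
  · have mP := (hPc t₀).measurable
    fun_prop
  · refine Filter.Eventually.of_forall fun z t ht => ?_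
    have hlt : t₀ / 2 < t := ht
    have hq : 0 < √(t₀ / 2) := Real.sqrt_pos.2 (by linarith)
    have hle : 1 / (2 * √t) ≤ c := by
      rw [hc]
      have : √(t₀ / 2) ≤ √t := Real.sqrt_le_sqrt hlt.le
      gcongr
    have hnn : 0 ≤ 1 / (2 * √t) := by positivity
    rw [Real.norm_eq_abs]
    refine (abs_add_le _ _).trans (add_le_add ?_ ?_) <;> rw [abs_mul]
    · refine mul_le_mul (h.bound₁ _) ?_ (abs_nonneg _) hM0
      refine (abs_add_le _ _).trans ?_
      rw [abs_one, abs_mul, abs_of_nonneg hnn]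
      gcongr
    · refine mul_le_mul (h.bound₂ _) ?_ (abs_nonneg _) hM0
      rw [abs_mul, abs_of_nonneg hnn]
      gcongr
  · exact (((integrable_const _).add (i1.const_mul _)).const_mul _).add
      ((i2.const_mul _).const_mul _)
  · refine Filter.Eventually.of_forall fun z t ht => ?_
    have hlt : t₀ / 2 < t := ht
    have ht0 : t ≠ 0 := by linarith
    have hsq := Real.hasDerivAt_sqrt ht0
    have hpath : HasDerivAt (fun t => P t z) (1 + 1 / (2 * √t) * z.1, 1 / (2 * √t) * z.2) t :=
      ((hasDerivAt_id t).add (hsq.mul_const z.1)).prodMk (hsq.mul_const z.2)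
    refine ((h.hasFDerivAt (P t z)).comp_hasDerivAt t hpath).congr_deriv ?_
    simp

end Gaussian

/-! ### The law of the rescaled couplings -/

section Product

variable {ι : Type*} [Fintype ι]

/-- The product of the laws `N(x b, x b) ⊗ N(0, x b)`: the law of the rescaled couplings
`(β b * J b, β b * K b)` at the point `x` of the Nishimori line. -/
noncomputable def nishimoriLaw (x : ι → ℝ) : Measure (ι → ℝ × ℝ) :=
  Measure.pi fun b => planarLaw (x b)

instance (x : ι → ℝ) : IsProbabilityMeasure (nishimoriLaw x) := by
  unfold nishimoriLaw; infer_instance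

/-- Resampling one coordinate of a product measure. -/
theorem measurePreserving_update_pi [DecidableEq ι] {E : Type*} [MeasurableSpace E]
    (μ ν : ι → Measure E) [∀ i, IsProbabilityMeasure (μ i)] [∀ i, IsProbabilityMeasure (ν i)]
    (b : ι) (h : ∀ i, i ≠ b → μ i = ν i) :
    MeasurePreserving (fun p : (ι → E) × E => Function.update p.1 b p.2)
      ((Measure.pi μ).prod (ν b)) (Measure.pi ν) := by
  have hm : Measurable (fun p : (ι → E) × E => Function.update p.1 b p.2) := measurable_update'
  refine ⟨hm, ?_⟩
  refine (Measure.pi_eq fun s hs => ?_).symm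
  rw [Measure.map_apply hm (MeasurableSet.univ_pi hs)]
  have : (fun p : (ι → E) × E => Function.update p.1 b p.2) ⁻¹' Set.univ.pi s
      = (Set.univ.pi (Function.update s b Set.univ)) ×ˢ s b := by
    ext p
    simp only [Set.mem_preimage, Set.mem_pi, Set.mem_univ, true_implies, Set.mem_prod]
    constructor
    · intro hp
      refine ⟨fun i => ?_, by simpa using hp b⟩
      by_cases hi : i = b
      · subst hi; simp
      · simpa [hi] using hp i
    · rintro ⟨h1, h2⟩ i
      by_cases hi : i = b
      · subst hi; simpa using h2
      · simpa [hi] using h1 i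
  rw [this, Measure.prod_prod, Measure.pi_pi, ← Finset.prod_erase_mul _ _ (Finset.mem_univ b),
    ← Finset.prod_erase_mul _ _ (Finset.mem_univ b)]
  simp only [Function.update_self, measure_univ, mul_one]
  congr 1
  refine Finset.prod_congr rfl fun i hi => ?_
  have hi' := Finset.ne_of_mem_erase hi
  rw [Function.update_of_ne hi', h i hi']

theorem measurePreserving_update_nishimoriLaw [DecidableEq ι] (x : ι → ℝ) (b : ι) (t : ℝ) :
    MeasurePreserving (fun p : (ι → ℝ × ℝ) × (ℝ × ℝ) => Function.update p.1 b p.2)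
      ((nishimoriLaw x).prod (planarLaw t)) (nishimoriLaw (Function.update x b t)) := by
  have := measurePreserving_update_pi (fun i => planarLaw (x i))
    (fun i => planarLaw (Function.update x b t i)) b
    (fun i hi => by rw [Function.update_of_ne hi])
  rw [Function.update_self] at this
  exact this

/-- Moving `x` in the coordinate `b` changes only the law of the coupling at `b`, the other
couplings being integrated against a law that does not move. -/
theorem integral_nishimoriLaw_update [DecidableEq ι] (x : ι → ℝ) (b : ι) (t : ℝ)
    {F : (ι → ℝ × ℝ) → ℝ} (hF : Integrable F (nishimoriLaw (Function.update x b t))) :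
    Integrable (fun ω => ∫ z, F (Function.update ω b z) ∂(planarLaw t)) (nishimoriLaw x) ∧
    ∫ ω, F ω ∂(nishimoriLaw (Function.update x b t))
      = ∫ ω, ∫ z, F (Function.update ω b z) ∂(planarLaw t) ∂(nishimoriLaw x) := by
  have hp := measurePreserving_update_nishimoriLaw x b t
  have h1 : Integrable (fun p : (ι → ℝ × ℝ) × (ℝ × ℝ) => F (Function.update p.1 b p.2))
      ((nishimoriLaw x).prod (planarLaw t)) := hp.integrable_comp_of_integrable hF
  refine ⟨h1.integral_prod_left, ?_⟩
  rw [← hp.map_eq] at hF ⊢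
  rw [integral_map hp.measurable.aemeasurable hF.aestronglyMeasurable, integral_prod _ h1]

/-- Along a coordinate line of the Nishimori line the expectation of `F` satisfies the heat
equation with drift in the corresponding coordinate of the disorder. -/
theorem hasDerivAt_integral_nishimoriLaw [DecidableEq ι] {M : ℝ}
    {F F₁ F₂ F₁₁ F₂₂ : (ι → ℝ × ℝ) → ℝ} {b : ι}
    (hF : Measurable F) (h₁ : Measurable F₁) (h₁₁ : Measurable F₁₁) (h₂₂ : Measurable F₂₂)
    (hjet : ∀ ω, PlanarJet M (fun z => F (Function.update ω b z))
      (fun z => F₁ (Function.update ω b z)) (fun z => F₂ (Function.update ω b z))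
      (fun z => F₁₁ (Function.update ω b z)) (fun z => F₂₂ (Function.update ω b z)))
    {x : ι → ℝ} (hx : 0 < x b)
    (hint : ∀ t, 0 < t → Integrable F (nishimoriLaw (Function.update x b t))) :
    HasDerivAt (fun t => ∫ ω, F ω ∂(nishimoriLaw (Function.update x b t)))
      (∫ ω, F₁ ω + (F₁₁ ω + F₂₂ ω) / 2 ∂(nishimoriLaw x)) (x b) := by
  set G : (ι → ℝ × ℝ) → ℝ := fun ω => F₁ ω + (F₁₁ ω + F₂₂ ω) / 2 with hG
  have hGm : Measurable G := by fun_prop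
  have hGb : ∀ ω, |G ω| ≤ 2 * M := by
    intro ω
    have := (hjet ω).abs_generator_le (ω b)
    simpa using this
  have hu : Measurable (fun p : (ι → ℝ × ℝ) × (ℝ × ℝ) => Function.update p.1 b p.2) :=
    measurable_update'
  have hGi : Integrable G (nishimoriLaw x) :=
    (integrable_const (2 * M)).mono' hGm.aestronglyMeasurable (Filter.Eventually.of_forall hGb)
  have hs : Set.Ioi (0 : ℝ) ∈ nhds (x b) := Ioi_mem_nhds hx
  have hmain := hasDerivAt_integral_of_dominated_loc_of_deriv_le (μ := nishimoriLaw x) hs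
    (F := fun t ω => ∫ z, F (Function.update ω b z) ∂(planarLaw t))
    (F' := fun t ω => ∫ z, G (Function.update ω b z) ∂(planarLaw t))
    (bound := fun _ => 2 * M) (x₀ := x b) ?_ ?_ ?_ ?_ ?_ ?_
  · have hev : (fun t => ∫ ω, F ω ∂(nishimoriLaw (Function.update x b t))) =ᶠ[nhds (x b)]
        fun t => ∫ ω, ∫ z, F (Function.update ω b z) ∂(planarLaw t) ∂(nishimoriLaw x) := by
      filter_upwards [hs] with t ht
      exact (integral_nishimoriLaw_update x b t (hint t ht)).2
    refine (hmain.2.congr_of_eventuallyEq hev).congr_deriv ?_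
    have := (integral_nishimoriLaw_update x b (x b) (F := G) (by simpa using hGi)).2
    rw [Function.update_eq_self] at this
    exact this.symm
  · refine Filter.Eventually.of_forall fun t => ?_
    exact ((hF.comp hu).stronglyMeasurable.integral_prod_right').aestronglyMeasurable
  · exact (integral_nishimoriLaw_update x b (x b) (hint _ hx)).1
  · exact ((hGm.comp hu).stronglyMeasurable.integral_prod_right').aestronglyMeasurable
  · refine Filter.Eventually.of_forall fun ω t _ => ?_
    refine (norm_integral_le_of_norm_le_const
      (Filter.Eventually.of_forall fun z => hGb (Function.update ω b z))).trans ?_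
    simp
  · exact integrable_const _
  · exact Filter.Eventually.of_forall fun ω t ht => (hjet ω).hasDerivAt_integral ht

theorem integrable_nishimoriLaw_abs {x : ι → ℝ} :
    Integrable (fun ω => ∑ b, (|(ω b).1| + |(ω b).2|)) (nishimoriLaw x) := by
  have key : ∀ m v, Integrable (fun s : ℝ => |s|) (gaussianReal m v) := fun m v =>
    ((memLp_id_gaussianReal (μ := m) (v := v) 1).integrable (le_refl _)).abs
  refine integrable_finsetSum _ fun b _ => ?_
  have h : Integrable (fun z : ℝ × ℝ => |z.1| + |z.2|) (planarLaw (x b)) :=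
    ((key _ _).comp_fst _).add ((key _ _).comp_snd _)
  exact integrable_comp_eval (μ := fun b => planarLaw (x b)) h

theorem pi_withDensity_ofReal {E : Type*} [MeasurableSpace E] (μ : ι → Measure E)
    [∀ i, SigmaFinite (μ i)] {f : ι → E → ℝ} (h0 : ∀ i z, 0 ≤ f i z)
    (hi : ∀ i, Integrable (f i) (μ i)) :
    Measure.pi (fun i => (μ i).withDensity fun z => ENNReal.ofReal (f i z))
      = (Measure.pi μ).withDensity fun ω => ENNReal.ofReal (∏ i, f i (ω i)) := by
  have hsf : ∀ i, SigmaFinite ((μ i).withDensity fun z => ENNReal.ofReal (f i z)) := fun i =>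
    SigmaFinite.withDensity_ofReal _
  refine Measure.pi_eq fun s hs => ?_
  rw [withDensity_apply _ (MeasurableSet.univ_pi hs)]
  simp_rw [withDensity_apply _ (hs _)]
  have e1 : ∀ i, ∫⁻ z in s i, ENNReal.ofReal (f i z) ∂(μ i)
      = ENNReal.ofReal (∫ z in s i, f i z ∂(μ i)) := fun i =>
    (ofReal_integral_eq_lintegral_ofReal (hi i).integrableOn
      (Filter.Eventually.of_forall (h0 i))).symm
  simp_rw [e1]
  rw [← ENNReal.ofReal_prod_of_nonneg fun i _ => integral_nonneg (h0 i), Measure.restrict_pi_pi,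
    ← integral_fintype_prod_eq_prod, ofReal_integral_eq_lintegral_ofReal]
  · exact Integrable.fintype_prod_dep fun i => (hi i).integrableOn
  · exact Filter.Eventually.of_forall fun ω => Finset.prod_nonneg fun i _ => h0 _ _

end Product

/-! ### Tilting and rotation invariance -/

section Gauge

variable {ι : Type*} [Fintype ι]

/-- The centred law `N(0, t) ⊗ N(0, t)`. -/
noncomputable def centredLaw (t : ℝ) : Measure (ℝ × ℝ) :=
  (gaussianReal 0 t.toNNReal).prod (gaussianReal 0 t.toNNReal)

instance (t : ℝ) : IsProbabilityMeasure (centredLaw t) := by unfold centredLaw; infer_instance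

theorem integrable_exp_centredLaw (t : ℝ) :
    Integrable (fun z : ℝ × ℝ => Real.exp (z.1 - t / 2)) (centredLaw t) := by
  have : Integrable (fun s : ℝ => Real.exp (s - t / 2)) (gaussianReal 0 t.toNNReal) := by
    have h := (integrable_exp_mul_gaussianReal (μ := 0) (v := t.toNNReal) 1).mul_const
      (Real.exp (-(t / 2)))
    refine h.congr (Filter.Eventually.of_forall fun s => ?_)
    simp only [one_mul, ← Real.exp_add, sub_eq_add_neg]
  exact this.comp_fst _

/-- Completing the square: the drift of the first coordinate is an exponential tilt of the
centred, rotation invariant law. This is where equality of mean and variance enters. -/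
theorem planarLaw_eq_withDensity {t : ℝ} (ht : 0 < t) :
    planarLaw t = (centredLaw t).withDensity fun z => ENNReal.ofReal (Real.exp (z.1 - t / 2)) := by
  have hv : t.toNNReal ≠ 0 := by simpa using ht
  have h : gaussianReal t t.toNNReal = (gaussianReal 0 t.toNNReal).withDensity
      fun s => ENNReal.ofReal (Real.exp (s - t / 2)) := by
    rw [gaussianReal_of_var_ne_zero _ hv, gaussianReal_of_var_ne_zero _ hv,
      ← withDensity_mul _ (measurable_gaussianPDF _ _) (by fun_prop)]
    congr 1
    ext s
    rw [Pi.mul_apply, gaussianPDF, gaussianPDF, ← ENNReal.ofReal_mul (gaussianPDFReal_nonneg _ _ _),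
      gaussianPDFReal, gaussianPDFReal, mul_assoc _ _ (Real.exp (s - t / 2)), ← Real.exp_add,
      Real.coe_toNNReal t ht.le]
    congr 3
    field_simp
    ring
  rw [planarLaw, h, prod_withDensity_left (by fun_prop), centredLaw]

theorem integral_nishimoriLaw_eq {x : ι → ℝ} (hx : ∀ b, 0 < x b) (G : (ι → ℝ × ℝ) → ℝ) :
    ∫ ω, G ω ∂(nishimoriLaw x) = ∫ ω, Real.exp (∑ b, ((ω b).1 - x b / 2)) * G ω
      ∂(Measure.pi fun b => centredLaw (x b)) := by
  have h : nishimoriLaw x = (Measure.pi fun b => centredLaw (x b)).withDensity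
      fun ω => ENNReal.ofReal (Real.exp (∑ b, ((ω b).1 - x b / 2))) := by
    simp_rw [nishimoriLaw, planarLaw_eq_withDensity (hx _), Real.exp_sum]
    exact pi_withDensity_ofReal (fun b => centredLaw (x b))
      (f := fun b z => Real.exp (z.1 - x b / 2))
      (fun b z => (Real.exp_pos _).le) fun b => integrable_exp_centredLaw _
  rw [h, integral_withDensity_eq_integral_toReal_smul (by fun_prop)
    (Filter.Eventually.of_forall fun _ => ENNReal.ofReal_lt_top)]
  simp only [ENNReal.toReal_ofReal (Real.exp_pos _).le, smul_eq_mul]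

theorem integrable_exp_sum_centredLaw (x : ι → ℝ) :
    Integrable (fun ω : ι → ℝ × ℝ => Real.exp (∑ b, ((ω b).1 - x b / 2)))
      (Measure.pi fun b => centredLaw (x b)) := by
  simp_rw [Real.exp_sum]
  exact Integrable.fintype_prod_dep fun b => integrable_exp_centredLaw (x b)

/-- The gauge transformation: the pair of couplings at `b` is rotated by the angle `-θ b`. -/
noncomputable def gauge (θ : ι → Real.Angle) (ω : ι → ℝ × ℝ) : ι → ℝ × ℝ := fun b =>
  ((θ b).cos * (ω b).1 + (θ b).sin * (ω b).2, -(θ b).sin * (ω b).1 + (θ b).cos * (ω b).2)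

theorem measurePreserving_gauge (θ : ι → Real.Angle) (x : ι → ℝ) :
    MeasurePreserving (gauge θ) (Measure.pi fun b => centredLaw (x b))
      (Measure.pi fun b => centredLaw (x b)) := by
  refine measurePreserving_pi (fun b => centredLaw (x b)) (fun b => centredLaw (x b))
    (f := fun b z => ((θ b).cos * z.1 + (θ b).sin * z.2, -(θ b).sin * z.1 + (θ b).cos * z.2))
    fun b => ⟨by fun_prop, ?_⟩
  induction θ b using Real.Angle.induction_on with
  | _ s =>
    have h := IsGaussian.map_rotation_eq_self (μ := gaussianReal 0 (x b).toNNReal)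
      (by simp) s
    simp only [Real.Angle.cos_coe, Real.Angle.sin_coe]
    exact h

end Gauge

/-! ### Exponential families with two fields -/

section Exponential

variable {X : Type*} [MeasurableSpace X]

/-- Bounded measurable real functions. -/
structure BddMeasurable (f : X → ℝ) : Prop where
  measurable : Measurable f
  bounded : ∃ M, ∀ φ, |f φ| ≤ M

theorem BddMeasurable.of_abs_le {f : X → ℝ} {M : ℝ} (hf : Measurable f) (h : ∀ φ, |f φ| ≤ M) :
    BddMeasurable f := ⟨hf, M, h⟩

theorem BddMeasurable.const (c : ℝ) : BddMeasurable fun _ : X => c :=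
  .of_abs_le measurable_const fun _ => le_refl _

theorem BddMeasurable.mul {f g : X → ℝ} (hf : BddMeasurable f) (hg : BddMeasurable g) :
    BddMeasurable fun φ => f φ * g φ := by
  obtain ⟨M, hM⟩ := hf.bounded
  obtain ⟨N, hN⟩ := hg.bounded
  refine .of_abs_le (M := M * N) (hf.measurable.mul hg.measurable) fun φ => ?_
  rw [abs_mul]
  exact mul_le_mul (hM φ) (hN φ) (abs_nonneg _) ((abs_nonneg _).trans (hM φ))

theorem BddMeasurable.sq {f : X → ℝ} (hf : BddMeasurable f) : BddMeasurable fun φ => f φ ^ 2 := by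
  simpa only [_root_.sq] using hf.mul hf

theorem BddMeasurable.add {f g : X → ℝ} (hf : BddMeasurable f) (hg : BddMeasurable g) :
    BddMeasurable fun φ => f φ + g φ := by
  obtain ⟨M, hM⟩ := hf.bounded
  obtain ⟨N, hN⟩ := hg.bounded
  exact .of_abs_le (M := M + N) (hf.measurable.add hg.measurable) fun φ =>
    (abs_add_le _ _).trans (add_le_add (hM φ) (hN φ))

theorem BddMeasurable.sum {ι : Type*} (s : Finset ι) {f : ι → X → ℝ}
    (hf : ∀ i, BddMeasurable (f i)) : BddMeasurable fun φ => ∑ i ∈ s, f i φ := by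
  classical
  induction s using Finset.induction_on with
  | empty => simpa using BddMeasurable.const (X := X) 0
  | insert i s hi ih => simp only [Finset.sum_insert hi]; exact (hf i).add ih

theorem BddMeasurable.exp {f : X → ℝ} (hf : BddMeasurable f) :
    BddMeasurable fun φ => Real.exp (f φ) := by
  obtain ⟨M, hM⟩ := hf.bounded
  refine .of_abs_le (M := Real.exp M) hf.measurable.exp fun φ => ?_
  rw [Real.abs_exp]
  exact Real.exp_le_exp.2 ((le_abs_self _).trans (hM φ))

theorem BddMeasurable.integrable {f : X → ℝ} (hf : BddMeasurable f) (ρ : Measure X)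
    [IsFiniteMeasure ρ] : Integrable f ρ := by
  obtain ⟨M, hM⟩ := hf.bounded
  exact (integrable_const M).mono' hf.measurable.aestronglyMeasurable
    (Filter.Eventually.of_forall hM)

theorem abs_integral_le_one {f : X → ℝ} {P : Measure X} [IsProbabilityMeasure P]
    (hf : ∀ φ, |f φ| ≤ 1) : |∫ φ, f φ ∂P| ≤ 1 := by
  have := norm_integral_le_of_norm_le_const (μ := P) (f := f) (C := 1)
    (Filter.Eventually.of_forall hf)
  simpa using this

/-- The truncated correlation `⟨f g⟩ - ⟨f⟩⟨g⟩` of the measure `P`. -/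
noncomputable def trunc (P : Measure X) (f g : X → ℝ) : ℝ :=
  ∫ φ, f φ * g φ ∂P - (∫ φ, f φ ∂P) * ∫ φ, g φ ∂P

theorem abs_trunc_le {f g : X → ℝ} {P : Measure X} [IsProbabilityMeasure P]
    (hf : ∀ φ, |f φ| ≤ 1) (hg : ∀ φ, |g φ| ≤ 1) : |trunc P f g| ≤ 2 := by
  have h1 : |∫ φ, f φ * g φ ∂P| ≤ 1 := abs_integral_le_one fun φ => by
    rw [abs_mul]; exact mul_le_one₀ (hf φ) (abs_nonneg _) (hg φ)
  have h2 : |(∫ φ, f φ ∂P) * ∫ φ, g φ ∂P| ≤ 1 := by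
    rw [abs_mul]
    exact mul_le_one₀ (abs_integral_le_one hf) (abs_nonneg _) (abs_integral_le_one hg)
  exact (abs_sub _ _).trans (by linarith)

/-- The third cumulant of `f, g, g`, written as the derivative of `⟨f g⟩ - ⟨f⟩⟨g⟩` in the field
conjugate to `g`. -/
noncomputable def trunc₃ (P : Measure X) (f g : X → ℝ) : ℝ :=
  trunc P (fun φ => f φ * g φ) g - (trunc P f g * (∫ φ, g φ ∂P) + (∫ φ, f φ ∂P) * trunc P g g)

theorem abs_trunc₃_le {f g : X → ℝ} {P : Measure X} [IsProbabilityMeasure P]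
    (hf : ∀ φ, |f φ| ≤ 1) (hg : ∀ φ, |g φ| ≤ 1) : |trunc₃ P f g| ≤ 6 := by
  have hfg : ∀ φ, |f φ * g φ| ≤ 1 := fun φ => by
    rw [abs_mul]; exact mul_le_one₀ (hf φ) (abs_nonneg _) (hg φ)
  have h1 : |trunc P f g * ∫ φ, g φ ∂P| ≤ 2 * 1 := by
    rw [abs_mul]
    exact mul_le_mul (abs_trunc_le hf hg) (abs_integral_le_one hg) (abs_nonneg _) zero_le_two
  have h2 : |(∫ φ, f φ ∂P) * trunc P g g| ≤ 1 * 2 := by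
    rw [abs_mul]
    exact mul_le_mul (abs_integral_le_one hf) (abs_trunc_le hg hg) (abs_nonneg _) zero_le_one
  have h3 := abs_trunc_le (P := P) hfg hg
  rw [abs_le] at *
  unfold trunc₃
  constructor <;> linarith [h1.1, h1.2, h2.1, h2.2, h3.1, h3.2]

variable {C S : X → ℝ}

theorem hasFDerivAt_integral_exp (ρ : Measure X) [IsFiniteMeasure ρ] {f : X → ℝ}
    (hf : BddMeasurable f) (hC : BddMeasurable C) (hS : BddMeasurable S) (z : ℝ × ℝ) :
    HasFDerivAt (fun z : ℝ × ℝ => ∫ φ, f φ * Real.exp (z.1 * C φ + z.2 * S φ) ∂ρ)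
      ((∫ φ, f φ * C φ * Real.exp (z.1 * C φ + z.2 * S φ) ∂ρ) • ContinuousLinearMap.fst ℝ ℝ ℝ
        + (∫ φ, f φ * S φ * Real.exp (z.1 * C φ + z.2 * S φ) ∂ρ) •
          ContinuousLinearMap.snd ℝ ℝ ℝ) z := by
  have hexp : ∀ z : ℝ × ℝ, BddMeasurable fun φ => Real.exp (z.1 * C φ + z.2 * S φ) := fun z =>
    (((BddMeasurable.const z.1).mul hC).add ((BddMeasurable.const z.2).mul hS)).exp
  have i1 := ((hf.mul hC).mul (hexp z)).integrable ρ
  have i2 := ((hf.mul hS).mul (hexp z)).integrable ρ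
  have v1 := i1.smul_const (ContinuousLinearMap.fst ℝ ℝ ℝ)
  have v2 := i2.smul_const (ContinuousLinearMap.snd ℝ ℝ ℝ)
  obtain ⟨M, hM⟩ := hf.bounded
  obtain ⟨N, hN⟩ := hC.bounded
  obtain ⟨K, hK⟩ := hS.bounded
  have hmain := hasFDerivAt_integral_of_dominated_of_fderiv_le (μ := ρ) (𝕜 := ℝ)
    (Metric.ball_mem_nhds z one_pos)
    (F := fun z φ => f φ * Real.exp (z.1 * C φ + z.2 * S φ))
    (F' := fun z φ => (f φ * C φ * Real.exp (z.1 * C φ + z.2 * S φ)) •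
      ContinuousLinearMap.fst ℝ ℝ ℝ + (f φ * S φ * Real.exp (z.1 * C φ + z.2 * S φ)) •
        ContinuousLinearMap.snd ℝ ℝ ℝ)
    (bound := fun _ => M * N * Real.exp ((‖z‖ + 1) * N + (‖z‖ + 1) * K)
      + M * K * Real.exp ((‖z‖ + 1) * N + (‖z‖ + 1) * K)) (x₀ := z) ?_ ?_ ?_ ?_ ?_ ?_
  · refine hmain.congr_fderiv ?_
    rw [integral_add v1 v2, integral_smul_const, integral_smul_const]
  · exact Filter.Eventually.of_forall fun z => ((hf.mul (hexp z)).integrable ρ).1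
  · exact (hf.mul (hexp z)).integrable ρ
  · exact (v1.add v2).1
  · refine Filter.Eventually.of_forall fun φ w hw => ?_
    have hwn : ‖w‖ ≤ ‖z‖ + 1 := by
      have h1 : ‖w - z‖ < 1 := by simpa [dist_eq_norm] using hw
      have h2 := norm_add_le z (w - z)
      rw [add_sub_cancel] at h2
      linarith
    have hM0 : 0 ≤ M := (abs_nonneg _).trans (hM φ)
    have hN0 : 0 ≤ N := (abs_nonneg _).trans (hN φ)
    have hK0 : 0 ≤ K := (abs_nonneg _).trans (hK φ)
    have he : Real.exp (w.1 * C φ + w.2 * S φ) ≤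
        Real.exp ((‖z‖ + 1) * N + (‖z‖ + 1) * K) := by
      refine Real.exp_le_exp.2 (add_le_add ?_ ?_)
      · refine (le_abs_self _).trans ?_
        rw [abs_mul]
        exact mul_le_mul ((norm_fst_le w).trans hwn) (hN φ) (abs_nonneg _) (by positivity)
      · refine (le_abs_self _).trans ?_
        rw [abs_mul]
        exact mul_le_mul ((norm_snd_le w).trans hwn) (hK φ) (abs_nonneg _) (by positivity)
    refine (norm_add_le _ _).trans (add_le_add ?_ ?_) <;>
      rw [norm_smul, Real.norm_eq_abs, abs_mul, abs_mul, Real.abs_exp]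
    · refine (mul_le_of_le_one_right (by positivity) (ContinuousLinearMap.norm_fst_le ..)).trans ?_
      gcongr
      exacts [hM φ, hN φ]
    · refine (mul_le_of_le_one_right (by positivity) (ContinuousLinearMap.norm_snd_le ..)).trans ?_
      gcongr
      exacts [hM φ, hK φ]
  · exact integrable_const _
  · refine Filter.Eventually.of_forall fun φ w _ => ?_
    have h1 : HasFDerivAt (fun z : ℝ × ℝ => z.1 * C φ + z.2 * S φ)
        (C φ • ContinuousLinearMap.fst ℝ ℝ ℝ + S φ • ContinuousLinearMap.snd ℝ ℝ ℝ) w :=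
      (hasFDerivAt_fst.mul_const (C φ)).add (hasFDerivAt_snd.mul_const (S φ))
    refine (h1.exp.const_mul (f φ)).congr_fderiv ?_
    simp only [smul_add, smul_smul]
    congr 2 <;> ring

/-- Gibbs measure with the two fields `z` conjugate to `C` and `S`. -/
noncomputable def planarState (ρ : Measure X) (C S : X → ℝ) (z : ℝ × ℝ) : Measure X :=
  ρ.tilted fun φ => z.1 * C φ + z.2 * S φ

theorem integral_tilted_eq_div (ρ : Measure X) (U f : X → ℝ) :
    ∫ φ, f φ ∂(ρ.tilted U) = (∫ φ, f φ * Real.exp (U φ) ∂ρ) / ∫ φ, Real.exp (U φ) ∂ρ := by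
  rw [integral_tilted, ← integral_div]
  congr 1
  ext φ
  rw [smul_eq_mul]
  ring

variable {ρ : Measure X} [IsFiniteMeasure ρ]

theorem hasFDerivAt_planarPartition (hC : BddMeasurable C) (hS : BddMeasurable S) (z : ℝ × ℝ) :
    HasFDerivAt (fun z : ℝ × ℝ => ∫ φ, Real.exp (z.1 * C φ + z.2 * S φ) ∂ρ)
      ((∫ φ, C φ * Real.exp (z.1 * C φ + z.2 * S φ) ∂ρ) • ContinuousLinearMap.fst ℝ ℝ ℝ
        + (∫ φ, S φ * Real.exp (z.1 * C φ + z.2 * S φ) ∂ρ) •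
          ContinuousLinearMap.snd ℝ ℝ ℝ) z := by
  simpa using hasFDerivAt_integral_exp ρ (BddMeasurable.const 1) hC hS z

variable [NeZero ρ]

theorem integral_planarExp_pos (hC : BddMeasurable C) (hS : BddMeasurable S) (z : ℝ × ℝ) :
    0 < ∫ φ, Real.exp (z.1 * C φ + z.2 * S φ) ∂ρ :=
  integral_exp_pos
    ((((BddMeasurable.const z.1).mul hC).add ((BddMeasurable.const z.2).mul hS)).exp.integrable ρ)

theorem hasFDerivAt_log_planarPartition (hC : BddMeasurable C) (hS : BddMeasurable S)
    (z : ℝ × ℝ) :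
    HasFDerivAt (fun z : ℝ × ℝ => Real.log (∫ φ, Real.exp (z.1 * C φ + z.2 * S φ) ∂ρ))
      ((∫ φ, C φ ∂(planarState ρ C S z)) • ContinuousLinearMap.fst ℝ ℝ ℝ
        + (∫ φ, S φ ∂(planarState ρ C S z)) • ContinuousLinearMap.snd ℝ ℝ ℝ) z := by
  refine ((hasFDerivAt_planarPartition hC hS z).log
    (integral_planarExp_pos hC hS z).ne').congr_fderiv ?_
  simp only [planarState, integral_tilted_eq_div, smul_add, smul_smul, div_eq_inv_mul]

/-- Fluctuation-response: the derivative of `⟨f⟩` in a field is a truncated correlation. -/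
theorem hasFDerivAt_planarAverage {f : X → ℝ} (hf : BddMeasurable f) (hC : BddMeasurable C)
    (hS : BddMeasurable S) (z : ℝ × ℝ) :
    HasFDerivAt (fun z : ℝ × ℝ => ∫ φ, f φ ∂(planarState ρ C S z))
      (trunc (planarState ρ C S z) f C • ContinuousLinearMap.fst ℝ ℝ ℝ
        + trunc (planarState ρ C S z) f S • ContinuousLinearMap.snd ℝ ℝ ℝ) z := by
  have hZ := (integral_planarExp_pos (ρ := ρ) hC hS z).ne'
  have h := (hasFDerivAt_integral_exp ρ hf hC hS z).mul
    ((hasDerivAt_inv hZ).comp_hasFDerivAt z (hasFDerivAt_planarPartition hC hS z))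
  simp only [planarState, trunc, integral_tilted_eq_div]
  refine h.congr_fderiv ?_
  ext <;> simp <;> field_simp <;> ring

theorem hasFDerivAt_trunc_planarState {f g : X → ℝ} (hf : BddMeasurable f) (hg : BddMeasurable g)
    (hC : BddMeasurable C) (hS : BddMeasurable S) (z : ℝ × ℝ) :
    HasFDerivAt (fun z : ℝ × ℝ => trunc (planarState ρ C S z) f g)
      ((trunc (planarState ρ C S z) (fun φ => f φ * g φ) C
          - (trunc (planarState ρ C S z) f C * (∫ φ, g φ ∂(planarState ρ C S z))
            + (∫ φ, f φ ∂(planarState ρ C S z)) * trunc (planarState ρ C S z) g C)) •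
          ContinuousLinearMap.fst ℝ ℝ ℝ
        + (trunc (planarState ρ C S z) (fun φ => f φ * g φ) S
          - (trunc (planarState ρ C S z) f S * (∫ φ, g φ ∂(planarState ρ C S z))
            + (∫ φ, f φ ∂(planarState ρ C S z)) * trunc (planarState ρ C S z) g S)) •
          ContinuousLinearMap.snd ℝ ℝ ℝ) z := by
  refine ((hasFDerivAt_planarAverage (hf.mul hg) hC hS z).sub
    ((hasFDerivAt_planarAverage hf hC hS z).mul
      (hasFDerivAt_planarAverage hg hC hS z))).congr_fderiv ?_
  ext <;> simp <;> ring

theorem hasDerivAt_fst_of_hasFDerivAt {F : ℝ × ℝ → ℝ} {a b : ℝ} {z : ℝ × ℝ}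
    (h : HasFDerivAt F (a • ContinuousLinearMap.fst ℝ ℝ ℝ + b • ContinuousLinearMap.snd ℝ ℝ ℝ) z) :
    HasDerivAt (fun s => F (s, z.2)) a z.1 := by
  have h1 : HasDerivAt (fun s : ℝ => (s, z.2)) ((1 : ℝ), (0 : ℝ)) z.1 :=
    (hasDerivAt_id z.1).prodMk (hasDerivAt_const _ _)
  refine (HasFDerivAt.comp_hasDerivAt z.1 (f := fun s : ℝ => (s, z.2)) h h1).congr_deriv ?_
  simp

theorem hasDerivAt_snd_of_hasFDerivAt {F : ℝ × ℝ → ℝ} {a b : ℝ} {z : ℝ × ℝ}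
    (h : HasFDerivAt F (a • ContinuousLinearMap.fst ℝ ℝ ℝ + b • ContinuousLinearMap.snd ℝ ℝ ℝ) z) :
    HasDerivAt (fun s => F (z.1, s)) b z.2 := by
  have h1 : HasDerivAt (fun s : ℝ => (z.1, s)) ((0 : ℝ), (1 : ℝ)) z.2 :=
    (hasDerivAt_const _ _).prodMk (hasDerivAt_id z.2)
  refine (HasFDerivAt.comp_hasDerivAt z.2 (f := fun s : ℝ => (z.1, s)) h h1).congr_deriv ?_
  simp

end Exponential

/-! ### Gibbs measures in given couplings -/

section Model

variable {ι X : Type*}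

/-- The modes `(C b, S b)` are unit vectors of the plane, as `(cos, sin)` of an angle. -/
structure UnitModes [MeasurableSpace X] (C S : ι → X → ℝ) : Prop where
  measurable_cos : ∀ b, Measurable (C b)
  measurable_sin : ∀ b, Measurable (S b)
  sq_add_sq : ∀ b φ, C b φ ^ 2 + S b φ ^ 2 = 1

variable {C S : ι → X → ℝ}

theorem UnitModes.abs_cos_le [MeasurableSpace X] (h : UnitModes C S) (b : ι) (φ : X) :
    |C b φ| ≤ 1 :=
  abs_le_one_iff_mul_self_le_one.2 (by nlinarith [h.sq_add_sq b φ, sq_nonneg (S b φ)])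

theorem UnitModes.abs_sin_le [MeasurableSpace X] (h : UnitModes C S) (b : ι) (φ : X) :
    |S b φ| ≤ 1 :=
  abs_le_one_iff_mul_self_le_one.2 (by nlinarith [h.sq_add_sq b φ, sq_nonneg (C b φ)])

theorem UnitModes.bdd_cos [MeasurableSpace X] (h : UnitModes C S) (b : ι) :
    BddMeasurable (C b) := .of_abs_le (h.measurable_cos b) (h.abs_cos_le b)

theorem UnitModes.bdd_sin [MeasurableSpace X] (h : UnitModes C S) (b : ι) :
    BddMeasurable (S b) := .of_abs_le (h.measurable_sin b) (h.abs_sin_le b)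

/-- Since `C ^ 2 + S ^ 2 = 1`, the Laplacian of `log Z` in the coupling at `b` is a function of
first moments. -/
theorem trunc_add_trunc [MeasurableSpace X] (h : UnitModes C S) (b : ι) (P : Measure X)
    [IsProbabilityMeasure P] :
    trunc P (C b) (C b) + trunc P (S b) (S b)
      = 1 - ((∫ φ, C b φ ∂P) ^ 2 + (∫ φ, S b φ ∂P) ^ 2) := by
  have h1 : (∫ φ, C b φ * C b φ ∂P) + ∫ φ, S b φ * S b φ ∂P = 1 := by
    rw [← integral_add (((h.bdd_cos b).mul (h.bdd_cos b)).integrable P)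
      (((h.bdd_sin b).mul (h.bdd_sin b)).integrable P)]
    simp [← sq, h.sq_add_sq]
  unfold trunc
  linear_combination h1

/-- The Laplacian of `⟨f⟩` in the coupling at `b`. Again the second moments of the mode `b` drop out
because `C ^ 2 + S ^ 2 = 1`. -/
theorem trunc₃_add_trunc₃ [MeasurableSpace X] (h : UnitModes C S) {f : X → ℝ} (hf : BddMeasurable f)
    (b : ι) (P : Measure X) [IsProbabilityMeasure P] :
    trunc₃ P f (C b) + trunc₃ P f (S b)
      = -2 * (trunc P f (C b) * (∫ φ, C b φ ∂P) + trunc P f (S b) * ∫ φ, S b φ ∂P) := by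
  have h1 : (∫ φ, f φ * C b φ * C b φ ∂P) + ∫ φ, f φ * S b φ * S b φ ∂P = ∫ φ, f φ ∂P := by
    rw [← integral_add (((hf.mul (h.bdd_cos b)).mul (h.bdd_cos b)).integrable P)
      (((hf.mul (h.bdd_sin b)).mul (h.bdd_sin b)).integrable P)]
    congr 1
    ext φ
    linear_combination f φ * h.sq_add_sq b φ
  have h2 := trunc_add_trunc h b P
  unfold trunc₃
  unfold trunc at h2 ⊢
  linear_combination h1 - (∫ φ, f φ ∂P) * h2

variable [Fintype ι]

/-- The exponent `∑ b, (h b * C b + k b * S b)` of the Gibbs weight in the couplings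
`ω b = (h b, k b)`. -/
def energy (C S : ι → X → ℝ) (ω : ι → ℝ × ℝ) (φ : X) : ℝ :=
  ∑ b, ((ω b).1 * C b φ + (ω b).2 * S b φ)

theorem energy_update [DecidableEq ι] (ω : ι → ℝ × ℝ) (b : ι) (z : ℝ × ℝ) :
    energy C S (Function.update ω b z)
      = energy C S (Function.update ω b 0) + fun φ => z.1 * C b φ + z.2 * S b φ := by
  ext φ
  simp only [energy, Pi.add_apply]
  rw [← Finset.sum_erase_add _ _ (Finset.mem_univ b),
    ← Finset.sum_erase_add (a := b) Finset.univ _ (Finset.mem_univ b)]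
  simp only [Function.update_self, Prod.fst_zero, Prod.snd_zero, zero_mul, add_zero]
  congr 1
  refine Finset.sum_congr rfl fun i hi => ?_
  rw [Function.update_of_ne (Finset.ne_of_mem_erase hi),
    Function.update_of_ne (Finset.ne_of_mem_erase hi)]

variable [MeasurableSpace X]

/-- The partition function in the couplings `ω`. -/
noncomputable def partition (ρ : Measure X) (C S : ι → X → ℝ) (ω : ι → ℝ × ℝ) : ℝ :=
  ∫ φ, Real.exp (energy C S ω φ) ∂ρ

/-- The Gibbs measure in the couplings `ω`. -/
noncomputable def state (ρ : Measure X) (C S : ι → X → ℝ) (ω : ι → ℝ × ℝ) : Measure X :=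
  ρ.tilted (energy C S ω)

variable {ρ : Measure X}

theorem UnitModes.bdd_energy (h : UnitModes C S) (ω : ι → ℝ × ℝ) :
    BddMeasurable (energy C S ω) :=
  BddMeasurable.sum _ fun b => ((BddMeasurable.const _).mul (h.bdd_cos b)).add
    ((BddMeasurable.const _).mul (h.bdd_sin b))

theorem UnitModes.measurable_energy (h : UnitModes C S) :
    Measurable fun p : (ι → ℝ × ℝ) × X => energy C S p.1 p.2 := by
  have h1 := h.measurable_cos
  have h2 := h.measurable_sin
  unfold energy
  fun_prop

theorem UnitModes.measurable_partition [SFinite ρ] (h : UnitModes C S) :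
    Measurable (partition ρ C S) :=
  (h.measurable_energy.exp.stronglyMeasurable.integral_prod_right').measurable

theorem UnitModes.measurable_average [SFinite ρ] (h : UnitModes C S) {f : X → ℝ}
    (hf : Measurable f) : Measurable fun ω => ∫ φ, f φ ∂(state ρ C S ω) := by
  simp only [state, integral_tilted_eq_div]
  have h1 : Measurable fun p : (ι → ℝ × ℝ) × X => f p.2 * Real.exp (energy C S p.1 p.2) :=
    (hf.comp _root_.measurable_snd).mul h.measurable_energy.exp
  exact (h1.stronglyMeasurable.integral_prod_right').measurable.div h.measurable_partition

theorem UnitModes.measurable_trunc [SFinite ρ] (h : UnitModes C S) {f g : X → ℝ}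
    (hf : Measurable f) (hg : Measurable g) : Measurable fun ω => trunc (state ρ C S ω) f g :=
  (h.measurable_average (hf.mul hg)).sub ((h.measurable_average hf).mul (h.measurable_average hg))

theorem UnitModes.measurable_trunc₃ [SFinite ρ] (h : UnitModes C S) {f g : X → ℝ}
    (hf : Measurable f) (hg : Measurable g) : Measurable fun ω => trunc₃ (state ρ C S ω) f g :=
  (h.measurable_trunc (hf.mul hg) hg).sub (((h.measurable_trunc hf hg).mul
    (h.measurable_average hg)).add ((h.measurable_average hf).mul (h.measurable_trunc hg hg)))

variable [IsFiniteMeasure ρ]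

/-- As a function of the coupling at `b`, the Gibbs measure is an exponential family with two
fields over the Gibbs measure in which that coupling is switched off. -/
theorem state_update [DecidableEq ι] (h : UnitModes C S) (ω : ι → ℝ × ℝ) (b : ι) (z : ℝ × ℝ) :
    state ρ C S (Function.update ω b z)
      = planarState (state ρ C S (Function.update ω b 0)) (C b) (S b) z := by
  rw [state, energy_update, planarState, state, tilted_tilted ((h.bdd_energy _).exp.integrable ρ)]

variable [NeZero ρ]

theorem isProbabilityMeasure_state (h : UnitModes C S) (ω : ι → ℝ × ℝ) :
    IsProbabilityMeasure (state ρ C S ω) :=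
  isProbabilityMeasure_tilted ((h.bdd_energy ω).exp.integrable ρ)

theorem partition_pos (h : UnitModes C S) (ω : ι → ℝ × ℝ) : 0 < partition ρ C S ω :=
  integral_exp_pos ((h.bdd_energy ω).exp.integrable ρ)

/-- The part of `log Z` that depends on the coupling at `b` is the logarithm of a partition function
of an exponential family with two fields. -/
theorem log_partition_update [DecidableEq ι] (h : UnitModes C S) (ω : ι → ℝ × ℝ) (b : ι)
    (z : ℝ × ℝ) :
    Real.log (partition ρ C S (Function.update ω b z))
      = Real.log (partition ρ C S (Function.update ω b 0)) + Real.log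
        (∫ φ, Real.exp (z.1 * C b φ + z.2 * S b φ) ∂(state ρ C S (Function.update ω b 0))) := by
  have h0 := (partition_pos (ρ := ρ) h (Function.update ω b 0)).ne'
  have := isProbabilityMeasure_state (ρ := ρ) h (Function.update ω b 0)
  have h1 := (integral_planarExp_pos (ρ := state ρ C S (Function.update ω b 0)) (h.bdd_cos b)
    (h.bdd_sin b) z).ne'
  rw [← Real.log_mul h0 h1, state, integral_exp_tilted, ← energy_update, ← partition, ← partition,
    mul_div_cancel₀ _ h0]

theorem planarJet_log_partition [DecidableEq ι] (h : UnitModes C S) (ω : ι → ℝ × ℝ) (b : ι) :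
    PlanarJet 6 (fun z => Real.log (partition ρ C S (Function.update ω b z)))
      (fun z => ∫ φ, C b φ ∂(state ρ C S (Function.update ω b z)))
      (fun z => ∫ φ, S b φ ∂(state ρ C S (Function.update ω b z)))
      (fun z => trunc (state ρ C S (Function.update ω b z)) (C b) (C b))
      (fun z => trunc (state ρ C S (Function.update ω b z)) (S b) (S b)) := by
  have hp := fun ω => isProbabilityMeasure_state (ρ := ρ) h ω
  have hp0 := hp (Function.update ω b 0)
  have hu : Measurable fun z : ℝ × ℝ => Function.update ω b z := measurable_update ω
  have hC := h.bdd_cos b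
  have hS := h.bdd_sin b
  refine
    { hasFDerivAt := fun z => ?_
      hasDerivAt_fst := fun z => ?_
      hasDerivAt_snd := fun z => ?_
      measurable₁ := (h.measurable_average hC.measurable).comp hu
      measurable₂ := (h.measurable_average hS.measurable).comp hu
      measurable₁₁ := (h.measurable_trunc hC.measurable hC.measurable).comp hu
      measurable₂₂ := (h.measurable_trunc hS.measurable hS.measurable).comp hu
      bound₁ := fun z => (abs_integral_le_one (h.abs_cos_le b)).trans (by norm_num)
      bound₂ := fun z => (abs_integral_le_one (h.abs_sin_le b)).trans (by norm_num)
      bound₁₁ := fun z => (abs_trunc_le (h.abs_cos_le b) (h.abs_cos_le b)).trans (by norm_num)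
      bound₂₂ := fun z => (abs_trunc_le (h.abs_sin_le b) (h.abs_sin_le b)).trans (by norm_num) }
  all_goals
    have hst := state_update (ρ := ρ) h ω b
    have hlog := log_partition_update (ρ := ρ) h ω b
    generalize state ρ C S (Function.update ω b 0) = ρ' at hst hlog hp0
    generalize Real.log (partition ρ C S (Function.update ω b 0)) = r at hlog
  · simp only [hlog, hst]
    exact (hasFDerivAt_log_planarPartition hC hS z).const_add _
  · simp only [hst]
    exact hasDerivAt_fst_of_hasFDerivAt (hasFDerivAt_planarAverage hC hC hS z)
  · simp only [hst]
    exact hasDerivAt_snd_of_hasFDerivAt (hasFDerivAt_planarAverage hS hC hS z)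

theorem planarJet_average [DecidableEq ι] (h : UnitModes C S) {f : X → ℝ} (hf : Measurable f)
    (hf1 : ∀ φ, |f φ| ≤ 1) (ω : ι → ℝ × ℝ) (b : ι) :
    PlanarJet 6 (fun z => ∫ φ, f φ ∂(state ρ C S (Function.update ω b z)))
      (fun z => trunc (state ρ C S (Function.update ω b z)) f (C b))
      (fun z => trunc (state ρ C S (Function.update ω b z)) f (S b))
      (fun z => trunc₃ (state ρ C S (Function.update ω b z)) f (C b))
      (fun z => trunc₃ (state ρ C S (Function.update ω b z)) f (S b)) := by
  have hp := fun ω => isProbabilityMeasure_state (ρ := ρ) h ω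
  have hp0 := hp (Function.update ω b 0)
  have hu : Measurable fun z : ℝ × ℝ => Function.update ω b z := measurable_update ω
  have hC := h.bdd_cos b
  have hS := h.bdd_sin b
  have hfb := BddMeasurable.of_abs_le hf hf1
  refine
    { hasFDerivAt := fun z => ?_
      hasDerivAt_fst := fun z => ?_
      hasDerivAt_snd := fun z => ?_
      measurable₁ := (h.measurable_trunc hf hC.measurable).comp hu
      measurable₂ := (h.measurable_trunc hf hS.measurable).comp hu
      measurable₁₁ := (h.measurable_trunc₃ hf hC.measurable).comp hu
      measurable₂₂ := (h.measurable_trunc₃ hf hS.measurable).comp hu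
      bound₁ := fun z => (abs_trunc_le hf1 (h.abs_cos_le b)).trans (by norm_num)
      bound₂ := fun z => (abs_trunc_le hf1 (h.abs_sin_le b)).trans (by norm_num)
      bound₁₁ := fun z => abs_trunc₃_le hf1 (h.abs_cos_le b)
      bound₂₂ := fun z => abs_trunc₃_le hf1 (h.abs_sin_le b) }
  all_goals
    have hst := state_update (ρ := ρ) h ω b
    generalize state ρ C S (Function.update ω b 0) = ρ' at hst hp0
  · simp only [hst]
    exact hasFDerivAt_planarAverage hfb hC hS z
  · simp only [hst]
    exact hasDerivAt_fst_of_hasFDerivAt (hasFDerivAt_trunc_planarState hfb hC hC hS z)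
  · simp only [hst]
    exact hasDerivAt_snd_of_hasFDerivAt (hasFDerivAt_trunc_planarState hfb hS hC hS z)

end Model

/-! ### Derivatives of disorder averages -/

section Disorder

variable {ι X : Type*} [Fintype ι] [MeasurableSpace X] {C S : ι → X → ℝ} {ρ : Measure X}
  [IsFiniteMeasure ρ] [NeZero ρ]

theorem UnitModes.abs_energy_le (h : UnitModes C S) (ω : ι → ℝ × ℝ) (φ : X) :
    |energy C S ω φ| ≤ ∑ b, (|(ω b).1| + |(ω b).2|) := by
  refine (Finset.abs_sum_le_sum_abs _ _).trans (Finset.sum_le_sum fun b _ => ?_)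
  refine (abs_add_le _ _).trans (add_le_add ?_ ?_) <;> rw [abs_mul]
  · exact mul_le_of_le_one_right (abs_nonneg _) (h.abs_cos_le b φ)
  · exact mul_le_of_le_one_right (abs_nonneg _) (h.abs_sin_le b φ)

theorem abs_log_partition_le (h : UnitModes C S) (ω : ι → ℝ × ℝ) :
    |Real.log (partition ρ C S ω)|
      ≤ |Real.log (ρ.real Set.univ)| + ∑ b, (|(ω b).1| + |(ω b).2|) := by
  set N := ∑ b, (|(ω b).1| + |(ω b).2|)
  have hm : 0 < ρ.real Set.univ := by
    simpa [Measure.real, ENNReal.toReal_pos_iff] using NeZero.ne ρ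
  have hi := (h.bdd_energy ω).exp.integrable ρ
  have hN := fun φ => abs_le.1 (h.abs_energy_le ω φ)
  have h1 : Real.exp (-N) * ρ.real Set.univ ≤ partition ρ C S ω := by
    have := integral_mono (integrable_const (Real.exp (-N))) hi
      (fun φ => Real.exp_le_exp.2 (hN φ).1)
    simpa [partition, mul_comm] using this
  have h2 : partition ρ C S ω ≤ Real.exp N * ρ.real Set.univ := by
    have := integral_mono hi (integrable_const (Real.exp N))
      (fun φ => Real.exp_le_exp.2 (hN φ).2)
    simpa [partition, mul_comm] using this
  have h3 := Real.log_le_log (by positivity) h1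
  have h4 := Real.log_le_log (partition_pos h ω) h2
  rw [Real.log_mul (Real.exp_ne_zero _) hm.ne', Real.log_exp] at h3 h4
  have h5 := abs_le.1 (le_refl |Real.log (ρ.real Set.univ)|)
  exact abs_le.2 ⟨by linarith [h5.1], by linarith [h5.2]⟩

theorem integrable_log_partition (h : UnitModes C S) (x : ι → ℝ) :
    Integrable (fun ω => Real.log (partition ρ C S ω)) (nishimoriLaw x) :=
  ((integrable_const _).add integrable_nishimoriLaw_abs).mono'
    h.measurable_partition.log.aestronglyMeasurable
    (Filter.Eventually.of_forall (abs_log_partition_le h))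

theorem bddMeasurable_average (h : UnitModes C S) {f : X → ℝ} (hf : Measurable f)
    (hf1 : ∀ φ, |f φ| ≤ 1) : BddMeasurable fun ω => ∫ φ, f φ ∂(state ρ C S ω) :=
  have := fun ω => isProbabilityMeasure_state (ρ := ρ) h ω
  .of_abs_le (h.measurable_average hf) fun _ => abs_integral_le_one hf1

theorem bddMeasurable_trunc (h : UnitModes C S) {f g : X → ℝ} (hf : Measurable f)
    (hf1 : ∀ φ, |f φ| ≤ 1) (hg : Measurable g) (hg1 : ∀ φ, |g φ| ≤ 1) :
    BddMeasurable fun ω => trunc (state ρ C S ω) f g :=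
  have := fun ω => isProbabilityMeasure_state (ρ := ρ) h ω
  .of_abs_le (h.measurable_trunc hf hg) fun _ => abs_trunc_le hf1 hg1

theorem hasDerivAt_integral_log_partition [DecidableEq ι] (h : UnitModes C S) {x : ι → ℝ} {b : ι}
    (hx : 0 < x b) :
    HasDerivAt
      (fun t => ∫ ω, Real.log (partition ρ C S ω) ∂(nishimoriLaw (Function.update x b t)))
      (∫ ω, (∫ φ, C b φ ∂(state ρ C S ω)) + (1 - ((∫ φ, C b φ ∂(state ρ C S ω)) ^ 2
        + (∫ φ, S b φ ∂(state ρ C S ω)) ^ 2)) / 2 ∂(nishimoriLaw x)) (x b) := by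
  have := fun ω => isProbabilityMeasure_state (ρ := ρ) h ω
  simp only [← trunc_add_trunc h]
  have hC := h.measurable_cos b
  have hS := h.measurable_sin b
  exact hasDerivAt_integral_nishimoriLaw (M := 6)
    (F₂ := fun ω => ∫ φ, S b φ ∂(state ρ C S ω)) h.measurable_partition.log
    (h.measurable_average hC) (h.measurable_trunc hC hC) (h.measurable_trunc hS hS)
    (fun ω => planarJet_log_partition (ρ := ρ) h ω b) hx
    (fun t _ => integrable_log_partition h _)

theorem hasDerivAt_integral_average [DecidableEq ι] (h : UnitModes C S) {f : X → ℝ}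
    (hf : Measurable f) (hf1 : ∀ φ, |f φ| ≤ 1) {x : ι → ℝ} {b : ι} (hx : 0 < x b) :
    HasDerivAt
      (fun t => ∫ ω, ∫ φ, f φ ∂(state ρ C S ω) ∂(nishimoriLaw (Function.update x b t)))
      (∫ ω, trunc (state ρ C S ω) f (C b)
        - (trunc (state ρ C S ω) f (C b) * (∫ φ, C b φ ∂(state ρ C S ω))
          + trunc (state ρ C S ω) f (S b) * ∫ φ, S b φ ∂(state ρ C S ω)) ∂(nishimoriLaw x))
      (x b) := by
  have := fun ω => isProbabilityMeasure_state (ρ := ρ) h ω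
  have hC := h.measurable_cos b
  have hS := h.measurable_sin b
  refine (hasDerivAt_integral_nishimoriLaw (M := 6)
    (F₂ := fun ω => trunc (state ρ C S ω) f (S b)) (h.measurable_average (ρ := ρ) hf)
    (h.measurable_trunc (ρ := ρ) hf hC) (h.measurable_trunc₃ (ρ := ρ) hf hC)
    (h.measurable_trunc₃ (ρ := ρ) hf hS)
    (fun ω => planarJet_average (ρ := ρ) h hf hf1 ω b) hx
    (fun t _ => (bddMeasurable_average h hf hf1).integrable _)).congr_deriv ?_
  congr 1
  ext ω
  rw [trunc₃_add_trunc₃ h (.of_abs_le hf hf1)]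
  ring

end Disorder

/-! ### Bilinearity of truncated correlations -/

section Bilinear

variable {X : Type*} [MeasurableSpace X] {P : Measure X} [IsFiniteMeasure P]

theorem integral_add_mul {f g : X → ℝ} (hf : BddMeasurable f) (hg : BddMeasurable g) (p q : ℝ) :
    ∫ φ, f φ * p + g φ * q ∂P = (∫ φ, f φ ∂P) * p + (∫ φ, g φ ∂P) * q := by
  rw [integral_add ((hf.integrable P).mul_const p) ((hg.integrable P).mul_const q),
    integral_mul_const, integral_mul_const]

theorem trunc_comm (P : Measure X) (f g : X → ℝ) : trunc P f g = trunc P g f := by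
  simp only [trunc, mul_comm]

theorem trunc_add_mul_left {f g k : X → ℝ} (hf : BddMeasurable f) (hg : BddMeasurable g)
    (hk : BddMeasurable k) (p q : ℝ) :
    trunc P (fun φ => f φ * p + g φ * q) k = trunc P f k * p + trunc P g k * q := by
  have e : ∀ φ, (f φ * p + g φ * q) * k φ = f φ * k φ * p + g φ * k φ * q := fun φ => by ring
  simp only [trunc, e]
  rw [integral_add_mul (hf.mul hk) (hg.mul hk), integral_add_mul hf hg]
  ring

theorem trunc_add_mul_right {f g k : X → ℝ} (hf : BddMeasurable f) (hg : BddMeasurable g)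
    (hk : BddMeasurable k) (p q : ℝ) :
    trunc P k (fun φ => f φ * p + g φ * q) = trunc P k f * p + trunc P k g * q := by
  rw [trunc_comm, trunc_add_mul_left hf hg hk, trunc_comm P f, trunc_comm P g]

end Bilinear

/-! ### Gauge covariance and the Nishimori identity -/

section GaugeCovariance

variable {ι X : Type*} [AddCommGroup X]

/-- The cosines of a family of angles depending additively on the configuration. -/
noncomputable def cosModes (A : ι → X →+ Real.Angle) (b : ι) (φ : X) : ℝ := (A b φ).cos

/-- The sines of a family of angles depending additively on the configuration. -/
noncomputable def sinModes (A : ι → X →+ Real.Angle) (b : ι) (φ : X) : ℝ := (A b φ).sin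

variable {A : ι → X →+ Real.Angle}

theorem cosModes_sub (b : ι) (φ ψ : X) : cosModes A b (φ - ψ)
    = cosModes A b φ * cosModes A b ψ + sinModes A b φ * sinModes A b ψ := by
  simp [cosModes, sinModes, sub_eq_add_neg, Real.Angle.cos_add]

theorem sinModes_sub (b : ι) (φ ψ : X) : sinModes A b (φ - ψ)
    = sinModes A b φ * cosModes A b ψ + cosModes A b φ * -sinModes A b ψ := by
  simp [cosModes, sinModes, sub_eq_add_neg, Real.Angle.sin_add]

theorem measurable_gauge [MeasurableSpace X] (hA : UnitModes (cosModes A) (sinModes A)) :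
    Measurable fun p : X × (ι → ℝ × ℝ) => gauge (fun b => A b p.1) p.2 := by
  have h1 : ∀ b, Measurable fun φ => (A b φ).cos := hA.measurable_cos
  have h2 : ∀ b, Measurable fun φ => (A b φ).sin := hA.measurable_sin
  have h3 : ∀ b, Measurable fun p : X × (ι → ℝ × ℝ) => (A b p.1).cos := fun b =>
    (h1 b).comp measurable_fst
  have h4 : ∀ b, Measurable fun p : X × (ι → ℝ × ℝ) => (A b p.1).sin := fun b =>
    (h2 b).comp measurable_fst
  unfold gauge
  fun_prop

variable [Fintype ι]

theorem energy_gauge (ω : ι → ℝ × ℝ) (φ ψ : X) :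
    energy (cosModes A) (sinModes A) (gauge (fun b => A b ψ) ω) φ
      = energy (cosModes A) (sinModes A) ω (φ + ψ) := by
  simp only [energy, gauge, cosModes, sinModes, map_add, Real.Angle.cos_add, Real.Angle.sin_add]
  exact Finset.sum_congr rfl fun b _ => by ring

/-- The drift of the gauge transformed couplings is the Gibbs exponent at the planted configuration
`ψ`. -/
theorem sum_gauge_fst (ω : ι → ℝ × ℝ) (x : ι → ℝ) (ψ : X) :
    ∑ b, ((gauge (fun b => A b ψ) ω b).1 - x b / 2)
      = energy (cosModes A) (sinModes A) ω ψ - ∑ b, x b / 2 := by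
  rw [Finset.sum_sub_distrib, energy]
  congr 1
  exact Finset.sum_congr rfl fun b _ => by simp only [gauge, cosModes, sinModes]; ring

variable [MeasurableSpace X] {ρ : Measure X}

/-- Gauge covariance of the Gibbs measure: a gauge transformation of the couplings is a translation
of the configuration. -/
theorem integral_state_gauge [MeasurableAdd X] [ρ.IsAddLeftInvariant] (ω : ι → ℝ × ℝ) (ψ : X)
    (f : X → ℝ) :
    ∫ φ, f φ ∂(state ρ (cosModes A) (sinModes A) (gauge (fun b => A b ψ) ω))
      = ∫ φ, f (φ - ψ) ∂(state ρ (cosModes A) (sinModes A) ω) := by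
  simp only [state, integral_tilted_eq_div, energy_gauge]
  congr 1
  · rw [← integral_add_right_eq_self (μ := ρ)
      (fun φ => f (φ - ψ) * Real.exp (energy (cosModes A) (sinModes A) ω φ)) ψ]
    simp
  · exact integral_add_right_eq_self (μ := ρ)
      (fun φ => Real.exp (energy (cosModes A) (sinModes A) ω φ)) ψ

theorem trunc_state_gauge [MeasurableAdd X] [ρ.IsAddLeftInvariant] (ω : ι → ℝ × ℝ) (ψ : X)
    (f g : X → ℝ) :
    trunc (state ρ (cosModes A) (sinModes A) (gauge (fun b => A b ψ) ω)) f g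
      = trunc (state ρ (cosModes A) (sinModes A) ω) (fun φ => f (φ - ψ)) fun φ => g (φ - ψ) := by
  simp only [trunc, integral_state_gauge]

variable [IsFiniteMeasure ρ] [NeZero ρ]

/-- The Nishimori identity: on the Nishimori line the disorder expectation of `G` is that of the
thermal average of `G` over all gauge transforms of the couplings. It is stated for a `G` for
which that average vanishes. -/
theorem integral_nishimoriLaw_eq_zero (hA : UnitModes (cosModes A) (sinModes A)) {x : ι → ℝ}
    (hx : ∀ b, 0 < x b) {G : (ι → ℝ × ℝ) → ℝ} (hG : BddMeasurable G)
    (h0 : ∀ ω, ∫ ψ, G (gauge (fun b => A b ψ) ω) ∂(state ρ (cosModes A) (sinModes A) ω) = 0) :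
    ∫ ω, G ω ∂(nishimoriLaw x) = 0 := by
  set γ := Measure.pi fun b => centredLaw (x b)
  set R : X → (ι → ℝ × ℝ) → ι → ℝ × ℝ := fun ψ ω => gauge (fun b => A b ψ) ω with hR
  have hRm : Measurable fun p : X × (ι → ℝ × ℝ) => R p.1 p.2 := measurable_gauge hA
  have hRp : ∀ ψ, MeasurePreserving (R ψ) γ γ := fun ψ => measurePreserving_gauge _ x
  set w : (ι → ℝ × ℝ) → ℝ := fun ω => Real.exp (∑ b, ((ω b).1 - x b / 2)) with hw
  have hwm : Measurable w := by fun_prop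
  have hwi : Integrable w γ := integrable_exp_sum_centredLaw x
  have hwR : Integrable (fun p : X × (ι → ℝ × ℝ) => w (R p.1 p.2)) (ρ.prod γ) := by
    have hwRm : Measurable fun p : X × (ι → ℝ × ℝ) => w (R p.1 p.2) := hwm.comp hRm
    rw [integrable_prod_iff hwRm.aestronglyMeasurable]
    refine ⟨Filter.Eventually.of_forall fun ψ => (hRp ψ).integrable_comp_of_integrable hwi, ?_⟩
    refine (integrable_const (∫ ω, ‖w ω‖ ∂γ)).congr (Filter.Eventually.of_forall fun ψ => ?_)
    have := integral_map (μ := γ) (hRp ψ).measurable.aemeasurable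
      (f := fun ω => ‖w ω‖) hwm.norm.aestronglyMeasurable
    rw [(hRp ψ).map_eq] at this
    exact this
  obtain ⟨M, hM⟩ := hG.bounded
  have hint : Integrable (fun p : X × (ι → ℝ × ℝ) => G (R p.1 p.2) * w (R p.1 p.2))
      (ρ.prod γ) :=
    hwR.bdd_mul (c := M) (hG.measurable.comp hRm).aestronglyMeasurable
      (Filter.Eventually.of_forall fun p => hM _)
  have hinv : ∀ ψ, ∫ ω, G (R ψ ω) * w (R ψ ω) ∂γ = ∫ ω, G ω ∂(nishimoriLaw x) := by
    intro ψ
    have := integral_map (μ := γ) (hRp ψ).measurable.aemeasurable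
      (f := fun ω => G ω * w ω) (hG.measurable.mul hwm).aestronglyMeasurable
    rw [(hRp ψ).map_eq] at this
    rw [integral_nishimoriLaw_eq hx, ← this]
    congr 1
    ext ω
    exact mul_comm _ _
  -- The gauge `ψ` does not matter for the disorder expectation, so it may be drawn from `ρ`; in the
  -- other order of integration its weight is the Gibbs weight in the couplings `ω`.
  have hswap := integral_integral_swap (f := fun ψ ω => G (R ψ ω) * w (R ψ ω)) hint
  simp only [hinv] at hswap
  have hz : ∀ ω, ∫ ψ, G (R ψ ω) * w (R ψ ω) ∂ρ = 0 := by
    intro ω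
    have h1 := h0 ω
    have hZ := (partition_pos (ρ := ρ) hA ω).ne'
    rw [partition] at hZ
    rw [state, integral_tilted_eq_div, div_eq_zero_iff, or_iff_left hZ] at h1
    simp only [hw, hR, sum_gauge_fst, Real.exp_sub, ← mul_div_assoc]
    rw [integral_div, h1, zero_div]
  simp only [hz, integral_zero, integral_const, smul_eq_mul, mul_eq_zero] at hswap
  refine hswap.resolve_left ?_
  simpa [Measure.real, ENNReal.toReal_eq_zero_iff] using NeZero.ne ρ

variable [MeasurableAdd X] [ρ.IsAddLeftInvariant]

/-- The planted configuration is distributed as a replica: `E⟨cos⟩ = E(⟨cos⟩ ^ 2 + ⟨sin⟩ ^ 2)`. -/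
theorem integral_average_cosModes (hA : UnitModes (cosModes A) (sinModes A)) {x : ι → ℝ}
    (hx : ∀ b, 0 < x b) (b : ι) :
    ∫ ω, (∫ φ, cosModes A b φ ∂(state ρ (cosModes A) (sinModes A) ω)) ^ 2
        + (∫ φ, sinModes A b φ ∂(state ρ (cosModes A) (sinModes A) ω)) ^ 2 ∂(nishimoriLaw x)
      = ∫ ω, ∫ φ, cosModes A b φ ∂(state ρ (cosModes A) (sinModes A) ω) ∂(nishimoriLaw x) := by
  have hC := bddMeasurable_average (ρ := ρ) hA (hA.measurable_cos b) (hA.abs_cos_le b)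
  have hS := bddMeasurable_average (ρ := ρ) hA (hA.measurable_sin b) (hA.abs_sin_le b)
  have hsq := (hC.mul hC).add (hS.mul hS)
  simp only [sq]
  rw [← sub_eq_zero, ← integral_sub (hsq.integrable _) (hC.integrable _)]
  have hneg := (BddMeasurable.const (X := ι → ℝ × ℝ) (-1)).mul hC
  refine integral_nishimoriLaw_eq_zero (ρ := ρ) hA hx ?_ fun ω => ?_
  · simpa [sub_eq_add_neg] using hsq.add hneg
  have := isProbabilityMeasure_state (ρ := ρ) hA ω
  set P := state ρ (cosModes A) (sinModes A) ω
  have iC := (hA.bdd_cos b).integrable P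
  have iS := (hA.bdd_sin b).integrable P
  simp only [integral_state_gauge, cosModes_sub, sinModes_sub]
  simp only [integral_add_mul (hA.bdd_cos b) (hA.bdd_sin b),
    integral_add_mul (hA.bdd_sin b) (hA.bdd_cos b)]
  set c := ∫ φ, cosModes A b φ ∂P with hc
  set s := ∫ φ, sinModes A b φ ∂P with hs
  have e : ∀ ψ, (c * cosModes A b ψ + s * sinModes A b ψ) * (c * cosModes A b ψ
      + s * sinModes A b ψ) + (s * cosModes A b ψ + c * -sinModes A b ψ) *
        (s * cosModes A b ψ + c * -sinModes A b ψ) - (c * cosModes A b ψ + s * sinModes A b ψ)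
      = (c ^ 2 + s ^ 2) - (c * cosModes A b ψ + s * sinModes A b ψ) := fun ψ => by
    linear_combination (c ^ 2 + s ^ 2) * hA.sq_add_sq b ψ
  have i2 : Integrable (fun ψ => c * cosModes A b ψ + s * sinModes A b ψ) P :=
    (iC.const_mul c).add (iS.const_mul s)
  simp only [e]
  rw [integral_sub (integrable_const _) i2, integral_add (iC.const_mul c) (iS.const_mul s),
    integral_const_mul, integral_const_mul, ← hc, ← hs, integral_const]
  simp
  ring

end GaugeCovariance

/-! ### Derivatives along the Nishimori line -/

section Correlation

variable {ι X : Type*} [AddCommGroup X] [Fintype ι] [MeasurableSpace X] {ρ : Measure X}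
  [IsFiniteMeasure ρ] [NeZero ρ] [MeasurableAdd X] [ρ.IsAddLeftInvariant]
  {A : ι → X →+ Real.Angle}

/-- Under a gauge transformation the four truncated correlations of the modes `a` and `b` form a
tensor `T`, whose contraction with the planted modes averages to `∑ T * ⟨u v⟩`, while the
correction terms average to `∑ T * ⟨u⟩⟨v⟩`; the difference is `∑ T ^ 2`. -/
theorem integral_generator_average_cosModes (hA : UnitModes (cosModes A) (sinModes A))
    {x : ι → ℝ} (hx : ∀ b, 0 < x b) (a b : ι) :
    ∫ ω, trunc (state ρ (cosModes A) (sinModes A) ω) (cosModes A a) (cosModes A b)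
        - (trunc (state ρ (cosModes A) (sinModes A) ω) (cosModes A a) (cosModes A b)
            * (∫ φ, cosModes A b φ ∂(state ρ (cosModes A) (sinModes A) ω))
          + trunc (state ρ (cosModes A) (sinModes A) ω) (cosModes A a) (sinModes A b)
            * ∫ φ, sinModes A b φ ∂(state ρ (cosModes A) (sinModes A) ω)) ∂(nishimoriLaw x)
      = ∫ ω, trunc (state ρ (cosModes A) (sinModes A) ω) (cosModes A a) (cosModes A b) ^ 2
        + trunc (state ρ (cosModes A) (sinModes A) ω) (cosModes A a) (sinModes A b) ^ 2
        + trunc (state ρ (cosModes A) (sinModes A) ω) (sinModes A a) (cosModes A b) ^ 2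
        + trunc (state ρ (cosModes A) (sinModes A) ω) (sinModes A a) (sinModes A b) ^ 2
        ∂(nishimoriLaw x) := by
  have bC := fun b => hA.bdd_cos b
  have bS := fun b => hA.bdd_sin b
  have mC := fun b => hA.measurable_cos b
  have mS := fun b => hA.measurable_sin b
  have tcc := bddMeasurable_trunc (ρ := ρ) hA (mC a) (hA.abs_cos_le a) (mC b) (hA.abs_cos_le b)
  have tcs := bddMeasurable_trunc (ρ := ρ) hA (mC a) (hA.abs_cos_le a) (mS b) (hA.abs_sin_le b)
  have tsc := bddMeasurable_trunc (ρ := ρ) hA (mS a) (hA.abs_sin_le a) (mC b) (hA.abs_cos_le b)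
  have tss := bddMeasurable_trunc (ρ := ρ) hA (mS a) (hA.abs_sin_le a) (mS b) (hA.abs_sin_le b)
  have hC := bddMeasurable_average (ρ := ρ) hA (mC b) (hA.abs_cos_le b)
  have hS := bddMeasurable_average (ρ := ρ) hA (mS b) (hA.abs_sin_le b)
  have hn := BddMeasurable.const (X := ι → ℝ × ℝ) (-1)
  have hL := tcc.add (hn.mul ((tcc.mul hC).add (tcs.mul hS)))
  have hQ := (((tcc.mul tcc).add (tcs.mul tcs)).add (tsc.mul tsc)).add (tss.mul tss)
  simp only [neg_mul, one_mul, ← sub_eq_add_neg, ← sq] at hL hQ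
  rw [← sub_eq_zero, ← integral_sub (hL.integrable _) (hQ.integrable _)]
  have hD := hL.add (hn.mul hQ)
  simp only [neg_mul, one_mul, ← sub_eq_add_neg] at hD
  refine integral_nishimoriLaw_eq_zero (ρ := ρ) hA hx hD fun ω => ?_
  have := isProbabilityMeasure_state (ρ := ρ) hA ω
  set P := state ρ (cosModes A) (sinModes A) ω
  simp only [trunc_state_gauge, integral_state_gauge, cosModes_sub, sinModes_sub]
  have bCr : ∀ p q, BddMeasurable fun φ => cosModes A b φ * p + sinModes A b φ * q := fun p q =>
    ((bC b).mul (.const p)).add ((bS b).mul (.const q))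
  have bSr : ∀ p q, BddMeasurable fun φ => sinModes A b φ * p + cosModes A b φ * q := fun p q =>
    ((bS b).mul (.const p)).add ((bC b).mul (.const q))
  simp only [trunc_add_mul_left (bC a) (bS a) (bCr _ _), trunc_add_mul_left (bC a) (bS a) (bSr _ _),
    trunc_add_mul_left (bS a) (bC a) (bCr _ _), trunc_add_mul_left (bS a) (bC a) (bSr _ _),
    trunc_add_mul_right (bC b) (bS b) (bC a), trunc_add_mul_right (bC b) (bS b) (bS a),
    trunc_add_mul_right (bS b) (bC b) (bC a), trunc_add_mul_right (bS b) (bC b) (bS a),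
    integral_add_mul (bC b) (bS b), integral_add_mul (bS b) (bC b)]
  set cc := trunc P (cosModes A a) (cosModes A b) with hcc
  set cs := trunc P (cosModes A a) (sinModes A b) with hcs
  set sc := trunc P (sinModes A a) (cosModes A b) with hsc
  set ss := trunc P (sinModes A a) (sinModes A b) with hss
  set c := ∫ φ, cosModes A b φ ∂P with hc
  set s := ∫ φ, sinModes A b φ ∂P with hs
  have icc := (((bC a).mul (bC b)).integrable P).const_mul cc
  have ics := (((bC a).mul (bS b)).integrable P).const_mul cs
  have isc := (((bS a).mul (bC b)).integrable P).const_mul sc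
  have iss := (((bS a).mul (bS b)).integrable P).const_mul ss
  have ic := ((bC a).integrable P).const_mul (cc * c + cs * s)
  have is := ((bS a).integrable P).const_mul (sc * c + ss * s)
  have i1 : Integrable (fun ψ => cc * (cosModes A a ψ * cosModes A b ψ)
      + cs * (cosModes A a ψ * sinModes A b ψ)) P := icc.add ics
  have i2 : Integrable (fun ψ => sc * (sinModes A a ψ * cosModes A b ψ)
      + ss * (sinModes A a ψ * sinModes A b ψ)) P := isc.add iss
  have i3 : Integrable (fun ψ => cc * (cosModes A a ψ * cosModes A b ψ)
      + cs * (cosModes A a ψ * sinModes A b ψ) + (sc * (sinModes A a ψ * cosModes A b ψ)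
      + ss * (sinModes A a ψ * sinModes A b ψ))) P := i1.add i2
  have i4 : Integrable (fun ψ => (cc * c + cs * s) * cosModes A a ψ
      + (sc * c + ss * s) * sinModes A a ψ) P := ic.add is
  have i5 : Integrable (fun ψ => cc * (cosModes A a ψ * cosModes A b ψ)
      + cs * (cosModes A a ψ * sinModes A b ψ) + (sc * (sinModes A a ψ * cosModes A b ψ)
      + ss * (sinModes A a ψ * sinModes A b ψ)) - ((cc * c + cs * s) * cosModes A a ψ
      + (sc * c + ss * s) * sinModes A a ψ)) P := i3.sub i4
  have key : ∫ ψ, cc * (cosModes A a ψ * cosModes A b ψ)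
      + cs * (cosModes A a ψ * sinModes A b ψ) + (sc * (sinModes A a ψ * cosModes A b ψ)
      + ss * (sinModes A a ψ * sinModes A b ψ)) - ((cc * c + cs * s) * cosModes A a ψ
      + (sc * c + ss * s) * sinModes A a ψ) - (cc ^ 2 + cs ^ 2 + sc ^ 2 + ss ^ 2) ∂P = 0 := by
    rw [integral_sub i5 (integrable_const _), integral_sub i3 i4, integral_add i1 i2,
      integral_add icc ics, integral_add isc iss, integral_add ic is]
    simp only [integral_const_mul, integral_const, probReal_univ, one_smul]
    simp only [hcc, hcs, hsc, hss, trunc, hc, hs]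
    ring
  rw [← key]
  congr 1
  ext ψ
  have ha := hA.sq_add_sq a ψ
  have hb := hA.sq_add_sq b ψ
  generalize cosModes A a ψ = u at *
  generalize sinModes A a ψ = v at *
  generalize cosModes A b ψ = p at *
  generalize sinModes A b ψ = q at *
  linear_combination (-(u * (cc * c + cs * s) + v * (sc * c + ss * s))
    - (cc ^ 2 + cs ^ 2 + sc ^ 2 + ss ^ 2)) * hb
    - (cc ^ 2 + cs ^ 2 + sc ^ 2 + ss ^ 2) * (p ^ 2 + q ^ 2) * ha

/-- The derivative of the quenched pressure is `(1 + E⟨cos⟩) / 2`. -/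
theorem hasDerivAt_integral_log_partition_cosModes [DecidableEq ι]
    (hA : UnitModes (cosModes A) (sinModes A)) {x : ι → ℝ} (hx : ∀ b, 0 < x b) (b : ι) :
    HasDerivAt (fun t => ∫ ω, Real.log (partition ρ (cosModes A) (sinModes A) ω)
        ∂(nishimoriLaw (Function.update x b t)))
      ((1 + ∫ ω, ∫ φ, cosModes A b φ ∂(state ρ (cosModes A) (sinModes A) ω) ∂(nishimoriLaw x)) / 2)
      (x b) := by
  refine (hasDerivAt_integral_log_partition (ρ := ρ) hA (hx b)).congr_deriv ?_
  have bC := bddMeasurable_average (ρ := ρ) hA (hA.measurable_cos b) (hA.abs_cos_le b)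
  have bS := bddMeasurable_average (ρ := ρ) hA (hA.measurable_sin b) (hA.abs_sin_le b)
  have bQ := (bC.mul bC).add (bS.mul bS)
  simp only [← sq] at bQ
  have iQ := bQ.integrable (nishimoriLaw x)
  have iH : Integrable (fun ω => (1
      - ((∫ φ, cosModes A b φ ∂(state ρ (cosModes A) (sinModes A) ω)) ^ 2
        + (∫ φ, sinModes A b φ ∂(state ρ (cosModes A) (sinModes A) ω)) ^ 2)) / 2)
      (nishimoriLaw x) := ((integrable_const 1).sub iQ).div_const 2
  rw [integral_add (bC.integrable _) iH, integral_div, integral_sub (integrable_const _) iQ,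
    integral_average_cosModes hA hx b]
  simp only [integral_const, probReal_univ, one_smul]
  ring

/-- The derivative of a quenched correlation is a sum of squares. -/
theorem hasDerivAt_integral_average_cosModes [DecidableEq ι]
    (hA : UnitModes (cosModes A) (sinModes A)) {x : ι → ℝ} (hx : ∀ b, 0 < x b) (a b : ι) :
    HasDerivAt (fun t => ∫ ω, ∫ φ, cosModes A a φ ∂(state ρ (cosModes A) (sinModes A) ω)
        ∂(nishimoriLaw (Function.update x b t)))
      ((∫ ω, trunc (state ρ (cosModes A) (sinModes A) ω) (cosModes A a) (cosModes A b) ^ 2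
          ∂(nishimoriLaw x))
        + (∫ ω, trunc (state ρ (cosModes A) (sinModes A) ω) (cosModes A a) (sinModes A b) ^ 2
          ∂(nishimoriLaw x))
        + (∫ ω, trunc (state ρ (cosModes A) (sinModes A) ω) (sinModes A a) (cosModes A b) ^ 2
          ∂(nishimoriLaw x))
        + ∫ ω, trunc (state ρ (cosModes A) (sinModes A) ω) (sinModes A a) (sinModes A b) ^ 2
          ∂(nishimoriLaw x)) (x b) := by
  refine (hasDerivAt_integral_average (ρ := ρ) hA (hA.measurable_cos a) (hA.abs_cos_le a)
    (hx b)).congr_deriv ?_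
  have mC := hA.measurable_cos
  have mS := hA.measurable_sin
  have bcc := (bddMeasurable_trunc (ρ := ρ) hA (mC a) (hA.abs_cos_le a) (mC b)
    (hA.abs_cos_le b)).sq
  have bcs := (bddMeasurable_trunc (ρ := ρ) hA (mC a) (hA.abs_cos_le a) (mS b)
    (hA.abs_sin_le b)).sq
  have bsc := (bddMeasurable_trunc (ρ := ρ) hA (mS a) (hA.abs_sin_le a) (mC b)
    (hA.abs_cos_le b)).sq
  have bss := (bddMeasurable_trunc (ρ := ρ) hA (mS a) (hA.abs_sin_le a) (mS b)
    (hA.abs_sin_le b)).sq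
  rw [integral_generator_average_cosModes hA hx a b,
    integral_add (((bcc.add bcs).add bsc).integrable _) (bss.integrable _),
    integral_add ((bcc.add bcs).integrable _) (bsc.integrable _),
    integral_add (bcc.integrable _) (bcs.integrable _)]

end Correlation

/-! ### Rescaling of the couplings -/

section Rescaling

variable {ι : Type*}

/-- The rescaled couplings `(β J, β K)`, on which alone the Gibbs measure depends. -/
def Couplings.rescale (c : Couplings ι) (ω : ι → ℝ × ℝ) (b : ι) : ℝ × ℝ :=
  (c.β b * (ω b).1, c.β b * (ω b).2)

/-- On the Nishimori line the rescaled couplings have mean and variance both equal to `x`, so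
their law depends on `(β, D, σ)` only through `x`. -/
theorem Couplings.measurePreserving_rescale [Fintype ι] {c : Couplings ι}
    (hc : c.OnNishimoriLine) : MeasurePreserving c.rescale (disorder c) (nishimoriLaw c.x) := by
  refine measurePreserving_pi
    (fun b => (gaussianReal (c.D b) (c.σ b ^ 2)).prod (gaussianReal 0 (c.σ b ^ 2)))
    (fun b => planarLaw (c.x b)) (f := fun b z => (c.β b * z.1, c.β b * z.2)) fun b => ?_
  have hσ : (0 : ℝ) < c.σ b := NNReal.coe_pos.2 (c.σ_pos b)
  have hD : c.D b = c.β b * (c.σ b : ℝ) ^ 2 := by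
    have := hc b
    rwa [div_eq_iff (by positivity)] at this
  have hx : 0 ≤ c.x b := mul_nonneg (c.β_pos b).le (c.D_nonneg b)
  have key : ∀ m : ℝ, MeasurePreserving (fun s : ℝ => c.β b * s) (gaussianReal m (c.σ b ^ 2))
      (gaussianReal (c.β b * m) (c.x b).toNNReal) := by
    intro m
    refine ⟨by fun_prop, ?_⟩
    rw [gaussianReal_map_const_mul]
    congr 1
    ext
    rw [Real.coe_toNNReal _ hx, Couplings.x, hD]
    push_cast
    ring
  have h2 := key 0
  rw [mul_zero] at h2
  exact (key (c.D b)).prod h2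

end Rescaling

/-! ### The gauge glass as a family of modes -/

instance : CompactSpace Real.Angle := by
  have hs : (fun t : ℝ => (t : Real.Angle)) '' Set.Icc (-Real.pi) Real.pi = Set.univ := by
    refine Set.eq_univ_of_forall fun θ => ⟨θ.toReal, ?_, Real.Angle.coe_toReal θ⟩
    exact ⟨(Real.Angle.neg_pi_lt_toReal θ).le, Real.Angle.toReal_le_pi θ⟩
  exact ⟨hs ▸ isCompact_Icc.image Real.Angle.continuous_coe⟩

section Model

variable {Λ : Type*} {Φ : AddSubgroup Real.Angle} {I : Finset (Λ × Λ × ℤ)}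

/-- The angles `m (φ_i - φ_j)` as additive functions of the configuration. -/
noncomputable def angleHom (I : Finset (Λ × Λ × ℤ)) (b : I) : (Λ → Φ) →+ Real.Angle where
  toFun := angle b.1
  map_zero' := by simp [angle]
  map_add' φ ψ := by
    simp only [angle, Pi.add_apply, AddSubgroup.coe_add, ← smul_add]
    congr 1
    abel

theorem cosModes_angleHom (b : I) :
    cosModes (angleHom (Φ := Φ) I) b = cosMode b.1 := rfl

theorem sinModes_angleHom (b : I) :
    sinModes (angleHom (Φ := Φ) I) b = sinMode b.1 := rfl

theorem neg_potential_eq (c : Couplings I) (ω : I → ℝ × ℝ) :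
    (fun φ : Λ → Φ => -potential c ω φ)
      = energy (cosModes (angleHom I)) (sinModes (angleHom I)) (c.rescale ω) := by
  ext φ
  simp only [potential, neg_neg, energy, Couplings.rescale, cosModes_angleHom, sinModes_angleHom]
  exact Finset.sum_congr rfl fun b _ => by ring

variable [Fintype Λ] [MeasurableSpace Φ]

theorem partitionFunction_eq (μ : Measure Φ) (c : Couplings I) (ω : I → ℝ × ℝ) :
    partitionFunction μ c ω = partition (Measure.pi fun _ : Λ => μ) (cosModes (angleHom I))
      (sinModes (angleHom I)) (c.rescale ω) := by
  rw [partition, ← neg_potential_eq, partitionFunction]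

theorem thermal_eq (μ : Measure Φ) (c : Couplings I) (ω : I → ℝ × ℝ) (f : (Λ → Φ) → ℝ) :
    thermal μ c ω f = ∫ φ, f φ ∂(state (Measure.pi fun _ : Λ => μ) (cosModes (angleHom I))
      (sinModes (angleHom I)) (c.rescale ω)) := by
  rw [state, integral_tilted_eq_div, ← neg_potential_eq, thermal, partitionFunction]

theorem truncated_eq (μ : Measure Φ) (c : Couplings I) (ω : I → ℝ × ℝ) (f g : (Λ → Φ) → ℝ) :
    truncated μ c ω f g = trunc (state (Measure.pi fun _ : Λ => μ) (cosModes (angleHom I))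
      (sinModes (angleHom I)) (c.rescale ω)) f g := by
  simp only [truncated, trunc, thermal_eq]

theorem unitModes_angleHom [CompactSpace Φ] [BorelSpace Φ] :
    UnitModes (cosModes (angleHom (Φ := Φ) I)) (sinModes (angleHom (Φ := Φ) I)) := by
  have hc : ∀ b : I, Continuous (angle (Φ := Φ) b.1) := fun b => by
    unfold angle
    fun_prop
  refine ⟨fun b => ?_, fun b => ?_, fun b φ => ?_⟩
  · exact (Real.Angle.continuous_cos.comp (hc b)).measurable
  · exact (Real.Angle.continuous_sin.comp (hc b)).measurable
  · exact Real.Angle.cos_sq_add_sin_sq _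

end Model

/-! ### Monotonicity from partial derivatives -/

/-- A function on the positive orthant with nonnegative partial derivatives is monotone. -/
theorem monotoneOn_of_partialDeriv_nonneg {ι : Type*} [Fintype ι] [DecidableEq ι]
    {f : (ι → ℝ) → ℝ} (hd : ∀ x : ι → ℝ, (∀ e, 0 < x e) → ∀ b, HasPartial b f x)
    (h0 : ∀ x : ι → ℝ, (∀ e, 0 < x e) → ∀ b, 0 ≤ partialDeriv b f x) :
    MonotoneOn f {x | ∀ e, 0 < x e} := by
  have hstep : ∀ x : ι → ℝ, (∀ e, 0 < x e) → ∀ (b : ι) (t : ℝ), x b ≤ t →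
      f x ≤ f (Function.update x b t) := by
    intro x hx b t ht
    have hpos : ∀ s : ℝ, 0 < s → ∀ e, 0 < Function.update x b s e := fun s hs e => by
      by_cases he : e = b
      · subst he; simpa using hs
      · simpa [he] using hx e
    have hdiff : ∀ s : ℝ, 0 < s → DifferentiableAt ℝ (fun r => f (Function.update x b r)) s := by
      intro s hs
      have := hd _ (hpos s hs) b
      simpa [HasPartial] using this
    have hmono : MonotoneOn (fun r => f (Function.update x b r)) (Set.Ioi 0) := by
      refine monotoneOn_of_deriv_nonneg (convex_Ioi 0)
        (fun s hs => (hdiff s hs).continuousAt.continuousWithinAt) ?_ ?_ <;> rw [interior_Ioi]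
      · exact fun s hs => (hdiff s hs).differentiableWithinAt
      · intro s hs
        have := h0 _ (hpos s hs) b
        simpa [partialDeriv] using this
    have := hmono (hx b) ((hx b).trans_le ht) ht
    simpa using this
  intro x hx y hy hxy
  -- The coordinates are raised from `x` to `y` one at a time.
  have key : ∀ s : Finset ι, f x ≤ f (s.piecewise y x) := by
    intro s
    induction s using Finset.induction_on with
    | empty => simp
    | insert b s hb ih =>
      rw [Finset.piecewise_insert]
      refine ih.trans (hstep _ (fun e => ?_) b _ ?_)
      · by_cases he : e ∈ s
        · simpa [he] using hy e
        · simpa [he] using hx e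
      · simpa [hb] using hxy b
  simpa using key Finset.univ

end GaugeGlass

open GaugeGlass in
theorem theorem2 {Λ : Type*} [Fintype Λ] [DecidableEq Λ]
    (Φ : AddSubgroup Real.Angle) (hΦ : IsClosed (Φ : Set Real.Angle))
    [MeasurableSpace Φ] [BorelSpace Φ] (μ : Measure Φ) [μ.IsAddHaarMeasure]
    (I : Finset (Λ × Λ × ℤ)) (c : (I → ℝ) → Couplings I)
    (hc : ∀ x : I → ℝ, (∀ b, 0 < x b) → (c x).OnNishimoriLine ∧ (c x).x = x)
    (a b : I) :
    (∀ x : I → ℝ, (∀ e, 0 < x e) →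
      -- the expectations and the partial derivatives exist
      (Integrable (fun ω => Real.log (partitionFunction μ (c x) ω)) (disorder (c x)) ∧
        Integrable (fun ω => thermal μ (c x) ω (cosMode a.1)) (disorder (c x)) ∧
        Integrable (fun ω => truncated μ (c x) ω (cosMode a.1) (cosMode b.1) ^ 2)
          (disorder (c x)) ∧
        Integrable (fun ω => truncated μ (c x) ω (cosMode a.1) (sinMode b.1) ^ 2)
          (disorder (c x)) ∧
        Integrable (fun ω => truncated μ (c x) ω (sinMode a.1) (cosMode b.1) ^ 2)
          (disorder (c x)) ∧
        Integrable (fun ω => truncated μ (c x) ω (sinMode a.1) (sinMode b.1) ^ 2)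
          (disorder (c x))) ∧
      HasPartial a (fun y => pressure μ (c y)) x ∧
      HasPartial b (partialDeriv a (fun y => pressure μ (c y))) x ∧
      HasPartial b (fun y => correlation μ (c y) a.1) x ∧
      -- the two identities and the inequality
      2 * partialDeriv b (partialDeriv a (fun y => pressure μ (c y))) x
        = partialDeriv b (fun y => correlation μ (c y) a.1) x ∧
      partialDeriv b (fun y => correlation μ (c y) a.1) x
        = (∫ ω, truncated μ (c x) ω (cosMode a.1) (cosMode b.1) ^ 2 ∂(disorder (c x)))
          + (∫ ω, truncated μ (c x) ω (cosMode a.1) (sinMode b.1) ^ 2 ∂(disorder (c x)))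
          + (∫ ω, truncated μ (c x) ω (sinMode a.1) (cosMode b.1) ^ 2 ∂(disorder (c x)))
          + (∫ ω, truncated μ (c x) ω (sinMode a.1) (sinMode b.1) ^ 2 ∂(disorder (c x))) ∧
      0 ≤ partialDeriv b (fun y => correlation μ (c y) a.1) x) ∧
    -- the quenched correlation increases along the Nishimori line
    MonotoneOn (fun x => correlation μ (c x) a.1) {x : I → ℝ | ∀ e, 0 < x e} := by
  have : CompactSpace Φ := isCompact_iff_compactSpace.1 hΦ.isCompact
  set ρ : Measure (Λ → Φ) := Measure.pi fun _ : Λ => μ with hρ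
  have : IsFiniteMeasure ρ := by rw [hρ]; infer_instance
  have : ρ.IsAddLeftInvariant := by rw [hρ]; infer_instance
  have : NeZero ρ := by rw [hρ]; infer_instance
  set C := cosModes (angleHom (Φ := Φ) I)
  set S := sinModes (angleHom (Φ := Φ) I)
  have hA : UnitModes C S := unitModes_angleHom
  have hC : ∀ d : I, Measurable (cosMode (Φ := Φ) d.1) := hA.measurable_cos
  have hS : ∀ d : I, Measurable (sinMode (Φ := Φ) d.1) := hA.measurable_sin
  have hpos : ∀ x : I → ℝ, (∀ e, 0 < x e) → ∀ (d : I) (s : ℝ), 0 < s →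
      ∀ e, 0 < Function.update x d s e := fun x hx d s hs e => by
    by_cases he : e = d
    · subst he; simpa using hs
    · simpa [he] using hx e
  have hmp : ∀ x : I → ℝ, (∀ e, 0 < x e) →
      MeasurePreserving (c x).rescale (disorder (c x)) (nishimoriLaw x) := fun x hx => by
    have := Couplings.measurePreserving_rescale (hc x hx).1
    rwa [(hc x hx).2] at this
  have hint : ∀ x : I → ℝ, (∀ e, 0 < x e) → ∀ G : (I → ℝ × ℝ) → ℝ, Measurable G →
      ∫ ω, G ((c x).rescale ω) ∂(disorder (c x)) = ∫ ω, G ω ∂(nishimoriLaw x) := by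
    intro x hx G hG
    rw [← (hmp x hx).map_eq, integral_map (hmp x hx).measurable.aemeasurable
      hG.aestronglyMeasurable]
  have hpress : ∀ x : I → ℝ, (∀ e, 0 < x e) → pressure μ (c x)
      = ∫ ω, Real.log (partition ρ C S ω) ∂(nishimoriLaw x) := fun x hx => by
    simp only [pressure, partitionFunction_eq]
    exact hint x hx (fun ω => Real.log (partition ρ C S ω)) hA.measurable_partition.log
  have hcorr : ∀ x : I → ℝ, (∀ e, 0 < x e) → ∀ d : I, correlation μ (c x) d.1
      = ∫ ω, ∫ φ, C d φ ∂(state ρ C S ω) ∂(nishimoriLaw x) := fun x hx d => by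
    simp only [correlation, thermal_eq]
    exact hint x hx (fun ω => ∫ φ, C d φ ∂(state ρ C S ω))
      (hA.measurable_average (hA.measurable_cos d))
  have htr_int : ∀ x : I → ℝ, (∀ e, 0 < x e) → ∀ {f g : (Λ → Φ) → ℝ}, Measurable f →
      (∀ φ, |f φ| ≤ 1) → Measurable g → (∀ φ, |g φ| ≤ 1) →
      Integrable (fun ω => truncated μ (c x) ω f g ^ 2) (disorder (c x)) ∧
      ∫ ω, truncated μ (c x) ω f g ^ 2 ∂(disorder (c x))
        = ∫ ω, trunc (state ρ C S ω) f g ^ 2 ∂(nishimoriLaw x) := by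
    intro x hx f g hf hf1 hg hg1
    have h := (bddMeasurable_trunc (ρ := ρ) hA hf hf1 hg hg1).sq
    simp only [truncated_eq]
    exact ⟨(hmp x hx).integrable_comp_of_integrable (h.integrable _),
      hint x hx (fun ω => trunc (state ρ C S ω) f g ^ 2) h.measurable⟩
  have hdp : ∀ x : I → ℝ, (∀ e, 0 < x e) → ∀ d : I,
      HasDerivAt (fun t => pressure μ (c (Function.update x d t)))
        ((1 + correlation μ (c x) d.1) / 2) (x d) := by
    intro x hx d
    have hev : (fun t => pressure μ (c (Function.update x d t))) =ᶠ[nhds (x d)] fun t =>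
        ∫ ω, Real.log (partition ρ C S ω) ∂(nishimoriLaw (Function.update x d t)) := by
      filter_upwards [Ioi_mem_nhds (hx d)] with t ht
      exact hpress _ (hpos x hx d t ht)
    rw [hcorr x hx d]
    exact (hasDerivAt_integral_log_partition_cosModes hA hx d).congr_of_eventuallyEq hev
  have hdc : ∀ x : I → ℝ, (∀ e, 0 < x e) → ∀ d : I,
      HasDerivAt (fun t => correlation μ (c (Function.update x d t)) a.1)
        ((∫ ω, truncated μ (c x) ω (cosMode a.1) (cosMode d.1) ^ 2 ∂(disorder (c x)))
          + (∫ ω, truncated μ (c x) ω (cosMode a.1) (sinMode d.1) ^ 2 ∂(disorder (c x)))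
          + (∫ ω, truncated μ (c x) ω (sinMode a.1) (cosMode d.1) ^ 2 ∂(disorder (c x)))
          + (∫ ω, truncated μ (c x) ω (sinMode a.1) (sinMode d.1) ^ 2 ∂(disorder (c x))))
        (x d) := by
    intro x hx d
    have hev : (fun t => correlation μ (c (Function.update x d t)) a.1) =ᶠ[nhds (x d)] fun t =>
        ∫ ω, ∫ φ, C a φ ∂(state ρ C S ω) ∂(nishimoriLaw (Function.update x d t)) := by
      filter_upwards [Ioi_mem_nhds (hx d)] with t ht
      exact hcorr _ (hpos x hx d t ht) a
    rw [(htr_int x hx (hC a) (hA.abs_cos_le a) (hC d) (hA.abs_cos_le d)).2,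
      (htr_int x hx (hC a) (hA.abs_cos_le a) (hS d) (hA.abs_sin_le d)).2,
      (htr_int x hx (hS a) (hA.abs_sin_le a) (hC d) (hA.abs_cos_le d)).2,
      (htr_int x hx (hS a) (hA.abs_sin_le a) (hS d) (hA.abs_sin_le d)).2]
    exact (hasDerivAt_integral_average_cosModes hA hx a d).congr_of_eventuallyEq hev
  have hnn : ∀ x : I → ℝ, (∀ e, 0 < x e) → ∀ d : I,
      0 ≤ partialDeriv d (fun y => correlation μ (c y) a.1) x := by
    intro x hx d
    rw [partialDeriv, (hdc x hx d).deriv]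
    have hsq : ∀ f g : (Λ → Φ) → ℝ,
        0 ≤ ∫ ω, truncated μ (c x) ω f g ^ 2 ∂(disorder (c x)) := fun f g =>
      integral_nonneg fun ω => sq_nonneg _
    exact add_nonneg (add_nonneg (add_nonneg (hsq _ _) (hsq _ _)) (hsq _ _)) (hsq _ _)
  refine ⟨fun x hx => ?_, monotoneOn_of_partialDeriv_nonneg
    (fun x hx d => (hdc x hx d).differentiableAt) hnn⟩
  have hdd : HasDerivAt
      (fun t => partialDeriv a (fun y => pressure μ (c y)) (Function.update x b t))
      (partialDeriv b (fun y => correlation μ (c y) a.1) x / 2) (x b) := by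
    have hev : (fun t => partialDeriv a (fun y => pressure μ (c y)) (Function.update x b t))
        =ᶠ[nhds (x b)] fun t => (1 + correlation μ (c (Function.update x b t)) a.1) / 2 := by
      filter_upwards [Ioi_mem_nhds (hx b)] with t ht
      exact (hdp _ (hpos x hx b t ht) a).deriv
    have h := ((hdc x hx b).differentiableAt.hasDerivAt.const_add 1).div_const 2
    exact h.congr_of_eventuallyEq hev
  refine ⟨⟨?_, ?_, (htr_int x hx (hC a) (hA.abs_cos_le a) (hC b) (hA.abs_cos_le b)).1,
    (htr_int x hx (hC a) (hA.abs_cos_le a) (hS b) (hA.abs_sin_le b)).1,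
    (htr_int x hx (hS a) (hA.abs_sin_le a) (hC b) (hA.abs_cos_le b)).1,
    (htr_int x hx (hS a) (hA.abs_sin_le a) (hS b) (hA.abs_sin_le b)).1⟩,
    (hdp x hx a).differentiableAt, hdd.differentiableAt, (hdc x hx b).differentiableAt, ?_,
    (hdc x hx b).deriv, hnn x hx b⟩
  · simp only [partitionFunction_eq]
    exact (hmp x hx).integrable_comp_of_integrable (integrable_log_partition hA x)
  · simp only [thermal_eq]
    exact (hmp x hx).integrable_comp_of_integrable
      ((bddMeasurable_average hA (hC a) (hA.abs_cos_le a)).integrable _)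
  · rw [partialDeriv, hdd.deriv]
    ring
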